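/- Work with algebras $\mathbf A=\langle A,\vee,\wedge,{}^*,{}',0,1\rangle$ whose operations have arities $2,2,1,1,0,0$. A Stone algebra is a bounded distributive lattice with an operation ${}^*$ satisfying $0^*\approx 1$, $1^*\approx 0$, $(x\vee y)^*\approx x^*\wedge y^*$, $(x\wedge y)^{**}\approx x^{**}\wedge y^{**}$, $x\le x^{**}$, $x^*\wedge x^{**}\approx 0$ and $x^*\vee x^{**}\approx 1$; dual Stone algebras are defined dually. A Kleene algebra is a bounded distributive lattice with an operation ${}'$ satisfying $0'\approx 1$, $1'\approx 0$, $(x\wedge y)'\approx x'\vee y'$, $x''\approx x$ and $x\wedge x'\le y\vee y'$. Consider the following four varieties. (1) $\mathbb{BA}$, Boolean algebras: $\langle A,\vee,\wedge,0,1\rangle$ is a bounded distributive lattice, $x\vee x^*\approx 1$, $x\wedge x^*\approx 0$, and $x'\approx x^*$. (2) $\mathbb{RDBLS}\mathrm t$, regular double Stone algebras: $\langle A,\vee,\wedge,{}^*,0,1\rangle$ is a Stone algebra, $\langle A,\vee,\wedge,{}',0,1\rangle$ is a dual Stone algebra, and $x\wedge x'\le y\vee y^*$. (3) $\mathbb{RKLS}\mathrm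 t$, regular Kleene Stone algebras: $\langle A,\vee,\wedge,{}^*,0,1\rangle$ is a Stone algebra, $\langle A,\vee,\wedge,{}',0,1\rangle$ is a Kleene algebra, and $x\wedge x'{}^*{}'\le y\vee y^*$. (4) $\mathbb{DMBA}$, De Morgan Boolean algebras: the variety generated by the algebra $\mathbf 4_{\mathbf{dmba}}$ on the four-element Boolean lattice $\{0,a,b,1\}$ in which ${}^*$ is the Boolean complement, $0'=1$, $1'=0$, $a'=a$ and $b'=b$. For first-order theories $T,T_1$ in the same language, $T_1$ is a model companion of $T$ if (i) every model of $T$ embeds into a model of $T_1$ and every model of $T_1$ embeds into a model of $T$, and (ii) $T_1$ is model-complete: whenever $\mathbf A,\mathbf B$ are models of $T_1$ and $\mathbf A$ is a substructure of $\mathbf B$, then $\mathbf A$ is an elementary substructure of $\mathbf B$. A class $\mathbb K$ has a model companion if its first-order theory $\mathrm{Th}(\mathbb K)$ has one. **Corollary.** If $\mathbb V\in\{\mathbb{BA},\mathbb{RDBLS}\mathrm t,\mathbb{RKLS}\mathrm t,\mathbb{DMBA}\}$, then $\mathbb V$ has a model companion. -/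

import Mathlib

universe u

namespace AlmostGautama

open FirstOrder FirstOrder.Language

/-! ### The language and its operations -/

/-- Function symbols of the language `⟨∨, ∧, *, ', 0, 1⟩`. -/
inductive AGFunc : ℕ → Type
  | join : AGFunc 2
  | meet : AGFunc 2
  | star : AGFunc 1
  | prime : AGFunc 1
  | zero : AGFunc 0
  | one : AGFunc 0

/-- The algebraic first-order language `⟨∨, ∧, *, ', 0, 1⟩`. -/
def agLang : FirstOrder.Language.{0, 0} where
  Functions := AGFunc
  Relations := fun _ => Empty

/-- The symbol `join` as a function symbol of `agLang`. -/
abbrev joinSymb : agLang.Functions 2 := AGFunc.join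

/-- The symbol `meet` as a function symbol of `agLang`. -/
abbrev meetSymb : agLang.Functions 2 := AGFunc.meet

/-- The symbol `star` as a function symbol of `agLang`. -/
abbrev starSymb : agLang.Functions 1 := AGFunc.star

/-- The symbol `prime` as a function symbol of `agLang`. -/
abbrev primeSymb : agLang.Functions 1 := AGFunc.prime

/-- The symbol `zero` as a function symbol of `agLang`. -/
abbrev zeroSymb : agLang.Functions 0 := AGFunc.zero

/-- The symbol `one` as a function symbol of `agLang`. -/
abbrev oneSymb : agLang.Functions 0 := AGFunc.one

section Operations

variable {A : Type u} [agLang.Structure A]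

/-- The operation `x ∨ y`. -/
def join (x y : A) : A := Structure.funMap joinSymb ![x, y]

/-- The operation `x ∧ y`. -/
def meet (x y : A) : A := Structure.funMap meetSymb ![x, y]

/-- The operation `x*`. -/
def star (x : A) : A := Structure.funMap starSymb ![x]

/-- The operation `x'` (written `x⁺` for double Stone algebras). -/
def prime (x : A) : A := Structure.funMap primeSymb ![x]

variable (A) in
/-- The constant `0`. -/
def zero : A := Structure.funMap zeroSymb ![]

variable (A) in
/-- The constant `1`. -/
def one : A := Structure.funMap oneSymb ![]

/-- The lattice order: `x ≤ y` iff `x ∧ y = x`. -/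
def le (x y : A) : Prop := meet x y = x

end Operations

/-! ### Equational conditions -/

section Identities

variable (A : Type u) [agLang.Structure A]

/-- `⟨A, ∨, ∧, 0, 1⟩` is a bounded distributive lattice. -/
structure IsBoundedDistribLattice : Prop where
  join_comm : ∀ x y : A, join x y = join y x
  meet_comm : ∀ x y : A, meet x y = meet y x
  join_assoc : ∀ x y z : A, join (join x y) z = join x (join y z)
  meet_assoc : ∀ x y z : A, meet (meet x y) z = meet x (meet y z)
  join_meet_self : ∀ x y : A, join x (meet x y) = x
  meet_join_self : ∀ x y : A, meet x (join x y) = x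
  meet_join_distrib : ∀ x y z : A, meet x (join y z) = join (meet x y) (meet x z)
  zero_le : ∀ x : A, le (zero A) x
  le_one : ∀ x : A, le x (one A)

/-- `⟨A, ∨, ∧, *, 0, 1⟩` is a Stone algebra: a distributive pseudocomplemented lattice
satisfying the Stone identity. -/
structure IsStone : Prop where
  lattice : IsBoundedDistribLattice A
  star_zero : star (zero A) = one A
  star_one : star (one A) = zero A
  star_join : ∀ x y : A, star (join x y) = meet (star x) (star y)
  star_star_meet : ∀ x y : A, star (star (meet x y)) = meet (star (star x)) (star (star y))
  le_star_star : ∀ x : A, le x (star (star x))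
  star_meet_star_star : ∀ x : A, meet (star x) (star (star x)) = zero A
  star_join_star_star : ∀ x : A, join (star x) (star (star x)) = one A

/-- `⟨A, ∨, ∧, ', 0, 1⟩` is a dual Stone algebra (the lattice dual of a Stone algebra). -/
structure IsDualStone : Prop where
  lattice : IsBoundedDistribLattice A
  prime_one : prime (one A) = zero A
  prime_zero : prime (zero A) = one A
  prime_meet : ∀ x y : A, prime (meet x y) = join (prime x) (prime y)
  prime_prime_join :
    ∀ x y : A, prime (prime (join x y)) = join (prime (prime x)) (prime (prime y))
  prime_prime_le : ∀ x : A, le (prime (prime x)) x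
  prime_join_prime_prime : ∀ x : A, join (prime x) (prime (prime x)) = one A
  prime_meet_prime_prime : ∀ x : A, meet (prime x) (prime (prime x)) = zero A

/-- `⟨A, ∨, ∧, ', 0, 1⟩` is a Kleene algebra. -/
structure IsKleene : Prop where
  lattice : IsBoundedDistribLattice A
  prime_zero : prime (zero A) = one A
  prime_one : prime (one A) = zero A
  prime_meet : ∀ x y : A, prime (meet x y) = join (prime x) (prime y)
  prime_prime : ∀ x : A, prime (prime x) = x
  kleene : ∀ x y : A, le (meet x (prime x)) (join y (prime y))

/-- Boolean algebras, in the language with `*` and `'`: both unary operations are the Boolean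
complement. -/
structure IsBoolean : Prop where
  lattice : IsBoundedDistribLattice A
  join_star : ∀ x : A, join x (star x) = one A
  meet_star : ∀ x : A, meet x (star x) = zero A
  prime_eq_star : ∀ x : A, prime x = star x

/-- Regular double Stone algebras (`x'` is the dual pseudocomplement `x⁺`). -/
structure IsRegularDoubleStone : Prop where
  stone : IsStone A
  dualStone : IsDualStone A
  regular : ∀ x y : A, le (meet x (prime x)) (join y (star y))

/-- Regular Kleene Stone algebras. -/
structure IsRegularKleeneStone : Prop where
  stone : IsStone A
  kleene : IsKleene A
  regular : ∀ x y : A, le (meet x (prime (star (prime x)))) (join y (star y))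

end Identities

/-! ### Classes of algebras, varieties, and generated varieties -/

/-- A class of algebras in the language `⟨∨, ∧, *, ', 0, 1⟩`. -/
abbrev AlgClass : Type (u + 1) := ∀ (A : Type u) [agLang.Structure A], Prop

/-- The direct product, with coordinatewise operations. -/
instance piStructure {I : Type*} (M : I → Type*) [∀ i, agLang.Structure (M i)] :
    agLang.Structure (∀ i, M i) where
  funMap f x := fun i => Structure.funMap f fun k => x k i
  RelMap r _ := r.elim

/-- A variety: a class closed under homomorphic images, subalgebras and direct products. -/
structure IsVariety (K : AlgClass.{u}) : Prop where
  image : ∀ (A B : Type u) [agLang.Structure A] [agLang.Structure B] (f : A →[agLang] B),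
    Function.Surjective f → K A → K B
  subalgebra : ∀ (A : Type u) [agLang.Structure A] (S : agLang.Substructure A), K A → K S
  product : ∀ (I : Type u) (M : I → Type u) [∀ i, agLang.Structure (M i)],
    (∀ i, K (M i)) → K (∀ i, M i)

/-- The variety `V(M)` generated by an algebra `M`: the algebras that lie in every variety
containing (all copies of) `M`. -/
def generatedVariety (M : Type) [agLang.Structure M] : AlgClass.{u} := fun A _ =>
  ∀ K : AlgClass.{u}, IsVariety K →
    (∀ (B : Type u) [agLang.Structure B], Nonempty (B ≃[agLang] M) → K B) → K A

/-- The universe of the four-element algebra `4_dmba`: here `0 = (0,0)`, `1 = (1,1)`,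
`a = (1,0)`, `b = (0,1)`. -/
def FourDMBA : Type := Bool × Bool

/-- The four-element Boolean lattice, with `*` the Boolean complement and with
`0' = 1`, `1' = 0`, `a' = a`, `b' = b`. -/
instance : agLang.Structure FourDMBA where
  funMap f x :=
    match f, x with
    | AGFunc.join, x => ((x 0).1 || (x 1).1, (x 0).2 || (x 1).2)
    | AGFunc.meet, x => ((x 0).1 && (x 1).1, (x 0).2 && (x 1).2)
    | AGFunc.star, x => (!(x 0).1, !(x 0).2)
    | AGFunc.prime, x => (!(x 0).2, !(x 0).1)
    | AGFunc.zero, _ => (false, false)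
    | AGFunc.one, _ => (true, true)
  RelMap r _ := r.elim

/-- The variety of Boolean algebras. -/
def BA : AlgClass.{u} := fun A _ => IsBoolean A

/-- The variety of regular double Stone algebras. -/
def RDBLSt : AlgClass.{u} := fun A _ => IsRegularDoubleStone A

/-- The variety of regular Kleene Stone algebras. -/
def RKLSt : AlgClass.{u} := fun A _ => IsRegularKleeneStone A

/-- The variety `V(4_dmba)` of De Morgan Boolean algebras. -/
def DMBA : AlgClass.{u} := generatedVariety FourDMBA

/-! ### Model companions -/

/-- `Th(K)`: the set of all first-order sentences true in every member of `K`. -/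
def Th (K : AlgClass.{u}) : agLang.Theory :=
  {φ | ∀ (A : Type u) [agLang.Structure A], K A → A ⊨ φ}

/-- Every model of `T` embeds into a model of `T₁`, and vice versa. -/
def MutuallyModelConsistent (T T₁ : agLang.Theory) : Prop :=
  (∀ (A : Type u) [agLang.Structure A], A ⊨ T →
    ∃ (B : Type u) (_ : agLang.Structure B), B ⊨ T₁ ∧ Nonempty (A ↪[agLang] B)) ∧
  (∀ (A : Type u) [agLang.Structure A], A ⊨ T₁ →
    ∃ (B : Type u) (_ : agLang.Structure B), B ⊨ T ∧ Nonempty (A ↪[agLang] B))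

/-- If `S` is a substructure of `B` and both are models of `T`, then `S` is an elementary
substructure of `B`. -/
def ModelComplete (T : agLang.Theory) : Prop :=
  ∀ (B : Type u) [agLang.Structure B] (S : agLang.Substructure B),
    B ⊨ T → S ⊨ T → S.IsElementary

/-- `T₁` is the model companion of `T`. -/
def IsModelCompanion (T₁ T : agLang.Theory) : Prop :=
  MutuallyModelConsistent.{u} T T₁ ∧ ModelComplete.{u} T₁

/-- The class `K` has a model companion, i.e. `Th(K)` has one. -/
def HasModelCompanion (K : AlgClass.{u}) : Prop :=
  ∃ T₁ : agLang.Theory, IsModelCompanion.{u} T₁ (Th K)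

end AlmostGautama

namespace AlmostGautama

open FirstOrder FirstOrder.Language

/-! ### Terms, homomorphisms and identities -/

section Terms

variable {α : Type*}

/-! Each of the four varieties is generated by one finite algebra `P`: the two-element Boolean
algebra, a three-element chain (double Stone or Kleene Stone), or `FourDMBA`. A prime filter of an
algebra `A` in the variety induces a homomorphism `A → P`, and these homomorphisms separate points;
in the two chain cases this is where regularity enters. The variety therefore consists of the
algebras satisfying the identities of `P`, and of the algebras separated by homomorphisms to `P`.
Three variables suffice, since no axiom uses more.

The companion is the theory of those algebras that contain a solution `c` of two equations `c* =
s(c)`, `c' = t(c)` and whose center `{x | x* = x'}` is atomless. The equations describe a generator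
`p₀` of `P` up to an injective endomorphism, so the homomorphisms sending `c` to `p₀` (the points)
still separate. With `c` as parameter, every constant of `P` and every set `{h | h x = p}` is named
by a term. Elements thus behave like locally constant `P`-valued functions on the set of points and
can be glued along clopen sets.

Model completeness is a back-and-forth argument (`IsTemplate.realize_iff`). The type of a finite
tuple is the set of patterns in `P` that it takes at points; splitting clopen sets in an atomless
center realises any prescribed extension of this set (`IsTemplate.exists_extension`). For `S ≤ B` a
tuple of `S` has the same patterns in both, because a pattern occurs exactly when an element of `S`
naming it is nonzero.

For mutual consistency, a separated `A` embeds into the `P`-valued functions on `Hom(A, P)` times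
Cantor space that depend on finitely many Cantor coordinates. There the constant `p₀` solves the
equations, and an unused coordinate splits any nonzero central element. -/

/-- The term `s ∨ t`. -/
def joinTerm (s t : agLang.Term α) : agLang.Term α := joinSymb.apply₂ s t

/-- The term `s ∧ t`. -/
def meetTerm (s t : agLang.Term α) : agLang.Term α := meetSymb.apply₂ s t

/-- The term `t*`. -/
def starTerm (t : agLang.Term α) : agLang.Term α := starSymb.apply₁ t

/-- The term `t'`. -/
def primeTerm (t : agLang.Term α) : agLang.Term α := primeSymb.apply₁ t

/-- The term `0`. -/
def zeroTerm : agLang.Term α := Term.func zeroSymb ![]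

/-- The term `1`. -/
def oneTerm : agLang.Term α := Term.func oneSymb ![]

variable {A : Type*} [agLang.Structure A] (v : α → A)

@[simp] lemma realize_joinTerm (s t : agLang.Term α) :
    (joinTerm s t).realize v = join (s.realize v) (t.realize v) :=
  Term.realize_functions_apply₂

@[simp] lemma realize_meetTerm (s t : agLang.Term α) :
    (meetTerm s t).realize v = meet (s.realize v) (t.realize v) :=
  Term.realize_functions_apply₂

@[simp] lemma realize_starTerm (t : agLang.Term α) :
    (starTerm t).realize v = star (t.realize v) :=
  Term.realize_functions_apply₁

@[simp] lemma realize_primeTerm (t : agLang.Term α) :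
    (primeTerm t).realize v = prime (t.realize v) :=
  Term.realize_functions_apply₁

@[simp] lemma realize_zeroTerm : (zeroTerm : agLang.Term α).realize v = zero A :=
  congrArg (Structure.funMap zeroSymb) (Subsingleton.elim _ _)

@[simp] lemma realize_oneTerm : (oneTerm : agLang.Term α).realize v = one A :=
  congrArg (Structure.funMap oneSymb) (Subsingleton.elim _ _)

end Terms

section Hom

variable {A B : Type*} [agLang.Structure A] [agLang.Structure B]
  {F : Type*} [FunLike F A B] [agLang.HomClass F A B] (f : F)

lemma map_join (x y : A) : f (join x y) = join (f x) (f y) :=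
  (HomClass.map_fun f joinSymb _).trans (congrArg _ (by ext i; fin_cases i <;> rfl))

lemma map_meet (x y : A) : f (meet x y) = meet (f x) (f y) :=
  (HomClass.map_fun f meetSymb _).trans (congrArg _ (by ext i; fin_cases i <;> rfl))

lemma map_star (x : A) : f (star x) = star (f x) :=
  (HomClass.map_fun f starSymb _).trans (congrArg _ (by ext i; fin_cases i; rfl))

lemma map_prime (x : A) : f (prime x) = prime (f x) :=
  (HomClass.map_fun f primeSymb _).trans (congrArg _ (by ext i; fin_cases i; rfl))

lemma map_zero : f (zero A) = zero B :=
  (HomClass.map_fun f zeroSymb _).trans (congrArg _ (Subsingleton.elim _ _))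

lemma map_one : f (one A) = one B :=
  (HomClass.map_fun f oneSymb _).trans (congrArg _ (Subsingleton.elim _ _))

/-- A map that preserves the six operations is a homomorphism. -/
def homOfOperations (g : A → B) (hj : ∀ x y, g (join x y) = join (g x) (g y))
    (hm : ∀ x y, g (meet x y) = meet (g x) (g y)) (hs : ∀ x, g (star x) = star (g x))
    (hp : ∀ x, g (prime x) = prime (g x)) (h0 : g (zero A) = zero B) (h1 : g (one A) = one B) :
    A →[agLang] B where
  toFun := g
  map_fun' {n} s x := by
    cases s
    · rw [show x = ![x 0, x 1] by ext i; fin_cases i <;> rfl]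
      refine (hj _ _).trans (congrArg (Structure.funMap joinSymb) ?_)
      ext i; fin_cases i <;> rfl
    · rw [show x = ![x 0, x 1] by ext i; fin_cases i <;> rfl]
      refine (hm _ _).trans (congrArg (Structure.funMap meetSymb) ?_)
      ext i; fin_cases i <;> rfl
    · rw [show x = ![x 0] by ext i; fin_cases i; rfl]
      refine (hs _).trans (congrArg (Structure.funMap starSymb) ?_)
      ext i; fin_cases i; rfl
    · rw [show x = ![x 0] by ext i; fin_cases i; rfl]
      refine (hp _).trans (congrArg (Structure.funMap primeSymb) ?_)
      ext i; fin_cases i; rfl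
    · rw [Subsingleton.elim x (![] : Fin 0 → A)]
      exact h0.trans (congrArg (Structure.funMap zeroSymb) (Subsingleton.elim _ _))
    · rw [Subsingleton.elim x (![] : Fin 0 → A)]
      exact h1.trans (congrArg (Structure.funMap oneSymb) (Subsingleton.elim _ _))
  map_rel' r _ := r.elim

/-- An injective homomorphism is an embedding, as the language has no relation symbols. -/
def embeddingOfInjective (g : A →[agLang] B) (hg : Function.Injective g) : A ↪[agLang] B where
  toFun := g
  inj' := hg
  map_fun' := g.map_fun'
  map_rel' r _ := r.elim

end Hom

/-! ### Transfer of axioms along identities. -/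

section Identities

variable (P A : Type*) [agLang.Structure P] [agLang.Structure A]

/-- `A` satisfies all identities in three variables that hold in `P`. -/
def SatisfiesIdentities : Prop :=
  ∀ s t : agLang.Term (Fin 3), (∀ v : Fin 3 → P, s.realize v = t.realize v) →
    ∀ v : Fin 3 → A, s.realize v = t.realize v

/-- The homomorphisms from `A` to `P` separate the points of `A`. -/
def Separated : Prop := ∀ x y : A, (∀ h : A →[agLang] P, h x = h y) → x = y

variable {P A}

lemma Separated.satisfiesIdentities (h : Separated P A) : SatisfiesIdentities P A := by
  intro s t hst v
  refine h _ _ fun f => ?_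
  rw [← HomClass.realize_term, ← HomClass.realize_term, hst]

lemma SatisfiesIdentities.of_models_Th {V : AlgClass.{u}}
    (hV : ∀ (B : Type u) [agLang.Structure B], V B → SatisfiesIdentities P B)
    {A : Type u} [agLang.Structure A] (hA : A ⊨ Th V) : SatisfiesIdentities P A := by
  intro s t hst v
  -- The universal closure of `s = t`: the three variables become bound ones, so that membership in
  -- `Th V` applies.
  let φ : agLang.Sentence := BoundedFormula.alls (n := 3)
    ((s.relabel Sum.inr : agLang.Term (Empty ⊕ Fin 3)) =' t.relabel Sum.inr)
  have key : ∀ (B : Type u) [agLang.Structure B],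
      B ⊨ φ ↔ ∀ w : Fin 3 → B, s.realize w = t.realize w := by
    intro B _
    refine BoundedFormula.realize_alls.trans (forall_congr' fun w => ?_)
    rw [BoundedFormula.realize_bdEqual, Term.realize_relabel, Term.realize_relabel]
    rfl
  exact (key A).1 (Theory.model_iff _ |>.1 hA φ fun B _ hB => (key B).2 (hV B hB s t hst)) v

/-- Every axiom, including the inequalities (`le` is an equation), is an identity in at most three
variables. Surplus variables receive arbitrary values. The same scheme serves the other axiom
systems below. -/
lemma IsBoundedDistribLattice.of_identities (hP : IsBoundedDistribLattice P)
    (hA : SatisfiesIdentities P A) : IsBoundedDistribLattice A where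
  join_comm x y := by
    simpa using hA (joinTerm (.var 0) (.var 1)) (joinTerm (.var 1) (.var 0))
      (fun v => by simpa using hP.join_comm _ _) ![x, y, y]
  meet_comm x y := by
    simpa using hA (meetTerm (.var 0) (.var 1)) (meetTerm (.var 1) (.var 0))
      (fun v => by simpa using hP.meet_comm _ _) ![x, y, y]
  join_assoc x y z := by
    simpa using hA (joinTerm (joinTerm (.var 0) (.var 1)) (.var 2))
      (joinTerm (.var 0) (joinTerm (.var 1) (.var 2)))
      (fun v => by simpa using hP.join_assoc _ _ _) ![x, y, z]
  meet_assoc x y z := by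
    simpa using hA (meetTerm (meetTerm (.var 0) (.var 1)) (.var 2))
      (meetTerm (.var 0) (meetTerm (.var 1) (.var 2)))
      (fun v => by simpa using hP.meet_assoc _ _ _) ![x, y, z]
  join_meet_self x y := by
    simpa using hA (joinTerm (.var 0) (meetTerm (.var 0) (.var 1))) (.var 0)
      (fun v => by simpa using hP.join_meet_self _ _) ![x, y, y]
  meet_join_self x y := by
    simpa using hA (meetTerm (.var 0) (joinTerm (.var 0) (.var 1))) (.var 0)
      (fun v => by simpa using hP.meet_join_self _ _) ![x, y, y]
  meet_join_distrib x y z := by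
    simpa using hA (meetTerm (.var 0) (joinTerm (.var 1) (.var 2)))
      (joinTerm (meetTerm (.var 0) (.var 1)) (meetTerm (.var 0) (.var 2)))
      (fun v => by simpa using hP.meet_join_distrib _ _ _) ![x, y, z]
  zero_le x := by
    simpa [le] using hA (meetTerm zeroTerm (.var 0)) zeroTerm
      (fun v => by simpa [le] using hP.zero_le _) ![x, x, x]
  le_one x := by
    simpa [le] using hA (meetTerm (.var 0) oneTerm) (.var 0)
      (fun v => by simpa [le] using hP.le_one _) ![x, x, x]

lemma IsStone.of_identities (hP : IsStone P) (hA : SatisfiesIdentities P A) : IsStone A where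
  lattice := hP.lattice.of_identities hA
  star_zero := by
    simpa using hA (starTerm zeroTerm) oneTerm (fun v => by simpa using hP.star_zero)
      (fun _ => zero A)
  star_one := by
    simpa using hA (starTerm oneTerm) zeroTerm (fun v => by simpa using hP.star_one)
      (fun _ => zero A)
  star_join x y := by
    simpa using hA (starTerm (joinTerm (.var 0) (.var 1)))
      (meetTerm (starTerm (.var 0)) (starTerm (.var 1)))
      (fun v => by simpa using hP.star_join _ _) ![x, y, y]
  star_star_meet x y := by
    simpa using hA (starTerm (starTerm (meetTerm (.var 0) (.var 1))))
      (meetTerm (starTerm (starTerm (.var 0))) (starTerm (starTerm (.var 1))))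
      (fun v => by simpa using hP.star_star_meet _ _) ![x, y, y]
  le_star_star x := by
    simpa [le] using hA (meetTerm (.var 0) (starTerm (starTerm (.var 0)))) (.var 0)
      (fun v => by simpa [le] using hP.le_star_star _) ![x, x, x]
  star_meet_star_star x := by
    simpa using hA (meetTerm (starTerm (.var 0)) (starTerm (starTerm (.var 0)))) zeroTerm
      (fun v => by simpa using hP.star_meet_star_star _) ![x, x, x]
  star_join_star_star x := by
    simpa using hA (joinTerm (starTerm (.var 0)) (starTerm (starTerm (.var 0)))) oneTerm
      (fun v => by simpa using hP.star_join_star_star _) ![x, x, x]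

lemma IsDualStone.of_identities (hP : IsDualStone P) (hA : SatisfiesIdentities P A) :
    IsDualStone A where
  lattice := hP.lattice.of_identities hA
  prime_one := by
    simpa using hA (primeTerm oneTerm) zeroTerm (fun v => by simpa using hP.prime_one)
      (fun _ => zero A)
  prime_zero := by
    simpa using hA (primeTerm zeroTerm) oneTerm (fun v => by simpa using hP.prime_zero)
      (fun _ => zero A)
  prime_meet x y := by
    simpa using hA (primeTerm (meetTerm (.var 0) (.var 1)))
      (joinTerm (primeTerm (.var 0)) (primeTerm (.var 1)))
      (fun v => by simpa using hP.prime_meet _ _) ![x, y, y]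
  prime_prime_join x y := by
    simpa using hA (primeTerm (primeTerm (joinTerm (.var 0) (.var 1))))
      (joinTerm (primeTerm (primeTerm (.var 0))) (primeTerm (primeTerm (.var 1))))
      (fun v => by simpa using hP.prime_prime_join _ _) ![x, y, y]
  prime_prime_le x := by
    simpa [le] using hA (meetTerm (primeTerm (primeTerm (.var 0))) (.var 0))
      (primeTerm (primeTerm (.var 0)))
      (fun v => by simpa [le] using hP.prime_prime_le _) ![x, x, x]
  prime_join_prime_prime x := by
    simpa using hA (joinTerm (primeTerm (.var 0)) (primeTerm (primeTerm (.var 0)))) oneTerm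
      (fun v => by simpa using hP.prime_join_prime_prime _) ![x, x, x]
  prime_meet_prime_prime x := by
    simpa using hA (meetTerm (primeTerm (.var 0)) (primeTerm (primeTerm (.var 0)))) zeroTerm
      (fun v => by simpa using hP.prime_meet_prime_prime _) ![x, x, x]

lemma IsKleene.of_identities (hP : IsKleene P) (hA : SatisfiesIdentities P A) : IsKleene A where
  lattice := hP.lattice.of_identities hA
  prime_zero := by
    simpa using hA (primeTerm zeroTerm) oneTerm (fun v => by simpa using hP.prime_zero)
      (fun _ => zero A)
  prime_one := by
    simpa using hA (primeTerm oneTerm) zeroTerm (fun v => by simpa using hP.prime_one)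
      (fun _ => zero A)
  prime_meet x y := by
    simpa using hA (primeTerm (meetTerm (.var 0) (.var 1)))
      (joinTerm (primeTerm (.var 0)) (primeTerm (.var 1)))
      (fun v => by simpa using hP.prime_meet _ _) ![x, y, y]
  prime_prime x := by
    simpa using hA (primeTerm (primeTerm (.var 0))) (.var 0)
      (fun v => by simpa using hP.prime_prime _) ![x, x, x]
  kleene x y := by
    simpa [le] using hA (meetTerm (meetTerm (.var 0) (primeTerm (.var 0)))
        (joinTerm (.var 1) (primeTerm (.var 1)))) (meetTerm (.var 0) (primeTerm (.var 0)))
      (fun v => by simpa [le] using hP.kleene _ _) ![x, y, y]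

lemma IsBoolean.of_identities (hP : IsBoolean P) (hA : SatisfiesIdentities P A) :
    IsBoolean A where
  lattice := hP.lattice.of_identities hA
  join_star x := by
    simpa using hA (joinTerm (.var 0) (starTerm (.var 0))) oneTerm
      (fun v => by simpa using hP.join_star _) ![x, x, x]
  meet_star x := by
    simpa using hA (meetTerm (.var 0) (starTerm (.var 0))) zeroTerm
      (fun v => by simpa using hP.meet_star _) ![x, x, x]
  prime_eq_star x := by
    simpa using hA (primeTerm (.var 0)) (starTerm (.var 0))
      (fun v => by simpa using hP.prime_eq_star _) ![x, x, x]

lemma IsRegularDoubleStone.of_identities (hP : IsRegularDoubleStone P)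
    (hA : SatisfiesIdentities P A) : IsRegularDoubleStone A where
  stone := hP.stone.of_identities hA
  dualStone := hP.dualStone.of_identities hA
  regular x y := by
    simpa [le] using hA (meetTerm (meetTerm (.var 0) (primeTerm (.var 0)))
        (joinTerm (.var 1) (starTerm (.var 1)))) (meetTerm (.var 0) (primeTerm (.var 0)))
      (fun v => by simpa [le] using hP.regular _ _) ![x, y, y]

lemma IsRegularKleeneStone.of_identities (hP : IsRegularKleeneStone P)
    (hA : SatisfiesIdentities P A) : IsRegularKleeneStone A where
  stone := hP.stone.of_identities hA
  kleene := hP.kleene.of_identities hA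
  regular x y := by
    simpa [le] using hA
      (meetTerm (meetTerm (.var 0) (primeTerm (starTerm (primeTerm (.var 0)))))
        (joinTerm (.var 1) (starTerm (.var 1))))
      (meetTerm (.var 0) (primeTerm (starTerm (primeTerm (.var 0)))))
      (fun v => by simpa [le] using hP.regular _ _) ![x, y, y]

variable (A) in
/-- `⟨A, ∨, ∧, *, 0, 1⟩` is a Boolean algebra and `'` is an antitone involution that commutes
with the complement. -/
structure IsDeMorganBoolean : Prop where
  lattice : IsBoundedDistribLattice A
  join_star : ∀ x : A, join x (star x) = one A
  meet_star : ∀ x : A, meet x (star x) = zero A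
  prime_zero : prime (zero A) = one A
  prime_one : prime (one A) = zero A
  prime_meet : ∀ x y : A, prime (meet x y) = join (prime x) (prime y)
  prime_join : ∀ x y : A, prime (join x y) = meet (prime x) (prime y)
  prime_prime : ∀ x : A, prime (prime x) = x
  prime_star : ∀ x : A, prime (star x) = star (prime x)

lemma IsDeMorganBoolean.of_identities (hP : IsDeMorganBoolean P)
    (hA : SatisfiesIdentities P A) : IsDeMorganBoolean A where
  lattice := hP.lattice.of_identities hA
  join_star x := by
    simpa using hA (joinTerm (.var 0) (starTerm (.var 0))) oneTerm
      (fun v => by simpa using hP.join_star _) ![x, x, x]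
  meet_star x := by
    simpa using hA (meetTerm (.var 0) (starTerm (.var 0))) zeroTerm
      (fun v => by simpa using hP.meet_star _) ![x, x, x]
  prime_zero := by
    simpa using hA (primeTerm zeroTerm) oneTerm (fun v => by simpa using hP.prime_zero)
      (fun _ => zero A)
  prime_one := by
    simpa using hA (primeTerm oneTerm) zeroTerm (fun v => by simpa using hP.prime_one)
      (fun _ => zero A)
  prime_meet x y := by
    simpa using hA (primeTerm (meetTerm (.var 0) (.var 1)))
      (joinTerm (primeTerm (.var 0)) (primeTerm (.var 1)))
      (fun v => by simpa using hP.prime_meet _ _) ![x, y, y]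
  prime_join x y := by
    simpa using hA (primeTerm (joinTerm (.var 0) (.var 1)))
      (meetTerm (primeTerm (.var 0)) (primeTerm (.var 1)))
      (fun v => by simpa using hP.prime_join _ _) ![x, y, y]
  prime_prime x := by
    simpa using hA (primeTerm (primeTerm (.var 0))) (.var 0)
      (fun v => by simpa using hP.prime_prime _) ![x, x, x]
  prime_star x := by
    simpa using hA (primeTerm (starTerm (.var 0))) (starTerm (primeTerm (.var 0)))
      (fun v => by simpa using hP.prime_star _) ![x, x, x]

end Identities

/-! ### Prime filters and representations -/

section PrimeFilters

variable {A : Type*} [agLang.Structure A]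

/-- The predicate `p` defines a prime filter of `A`. -/
structure IsPrimeFilter (p : A → Prop) : Prop where
  meet_iff : ∀ x y, p (meet x y) ↔ p x ∧ p y
  join_iff : ∀ x y, p (join x y) ↔ p x ∨ p y
  one_mem : p (one A)
  zero_notMem : ¬ p (zero A)

lemma IsPrimeFilter.mono {p : A → Prop} (hp : IsPrimeFilter p) {x y : A} (h : le x y) (hx : p x) :
    p y := by
  rw [← h, hp.meet_iff] at hx
  exact hx.2

/-- A bounded distributive lattice in the sense of Mathlib. -/
abbrev IsBoundedDistribLattice.toDistribLattice (h : IsBoundedDistribLattice A) :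
    DistribLattice A :=
  letI : Max A := ⟨join⟩
  letI : Min A := ⟨meet⟩
  letI : Lattice A := Lattice.mk' h.join_comm h.join_assoc h.meet_comm h.meet_assoc
    h.join_meet_self h.meet_join_self
  DistribLattice.ofInfSupLe fun a b c => (h.meet_join_distrib a b c).le

/-- The prime ideal theorem separates the principal filter of `x` from the principal ideal of `y`;
the filter wanted is the complement of the prime ideal. -/
lemma IsBoundedDistribLattice.exists_isPrimeFilter (h : IsBoundedDistribLattice A) {x y : A}
    (hxy : ¬ le x y) : ∃ p : A → Prop, IsPrimeFilter p ∧ p x ∧ ¬ p y := by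
  let _ := h.toDistribLattice
  have hle : ∀ a b : A, le a b ↔ a ≤ b := fun a b => inf_eq_left
  have hdisj : Disjoint (Order.PFilter.principal x : Set A) (Order.Ideal.principal y : Set A) := by
    refine Set.disjoint_left.2 fun z hz hz' => hxy ((hle _ _).2 ?_)
    exact le_trans (Order.PFilter.mem_principal.1 hz) (Order.Ideal.mem_principal.1 hz')
  obtain ⟨J, hJ, hyJ, hxJ⟩ := DistribLattice.prime_ideal_of_disjoint_filter_ideal hdisj
  have hmem : ∀ a b : A, a ⊓ b ∈ J ↔ a ∈ J ∨ b ∈ J := fun a b =>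
    ⟨hJ.mem_or_mem, fun hab => hab.elim (fun ha => J.lower inf_le_left ha)
      fun hb => J.lower inf_le_right hb⟩
  have hx : x ∉ J := fun hx => Set.disjoint_left.1 hxJ (Order.PFilter.mem_principal.2 le_rfl) hx
  have hy : y ∈ J := hyJ (Order.Ideal.mem_principal.2 le_rfl)
  refine ⟨fun a => a ∉ J, ⟨fun a b => ?_, fun a b => ?_, fun h1 => ?_, fun h0 => h0 ?_⟩, hx,
    not_not.2 hy⟩
  · exact (not_congr (hmem a b)).trans not_or
  · exact (not_congr (Order.Ideal.sup_mem_iff)).trans not_and_or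
  · exact hx (J.lower ((hle _ _).1 (h.le_one x)) h1)
  · exact J.lower ((hle _ _).1 (h.zero_le y)) hy

lemma IsBoundedDistribLattice.eq_of_le (h : IsBoundedDistribLattice A) {x y : A}
    (hxy : le x y) (hyx : le y x) : x = y := by
  rw [← hxy, h.meet_comm, hyx]

lemma IsBoundedDistribLattice.eq_of_isPrimeFilter (h : IsBoundedDistribLattice A) {x y : A}
    (hxy : ∀ p : A → Prop, IsPrimeFilter p → (p x ↔ p y)) : x = y := by
  refine h.eq_of_le ?_ ?_ <;> by_contra hn
  · obtain ⟨p, hp, hx, hy⟩ := h.exists_isPrimeFilter hn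
    exact hy ((hxy p hp).1 hx)
  · obtain ⟨p, hp, hx, hy⟩ := h.exists_isPrimeFilter hn
    exact hy ((hxy p hp).2 hx)

lemma IsPrimeFilter.compl_iff {p : A → Prop} (hp : IsPrimeFilter p) {x y : A}
    (hj : join x y = one A) (hm : meet x y = zero A) : p y ↔ ¬ p x := by
  have h1 := hp.one_mem
  have h0 := hp.zero_notMem
  rw [← hj, hp.join_iff] at h1
  rw [← hm, hp.meet_iff] at h0
  tauto

end PrimeFilters

/-- This lets `decide` check order axioms in the finite algebras. -/
instance {P : Type*} [agLang.Structure P] [DecidableEq P] (x y : P) : Decidable (le x y) :=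
  inferInstanceAs (Decidable (meet x y = x))

/-! #### Boolean algebras -/

/-- The universe of the two-element Boolean algebra. -/
def TwoBA : Type := Bool

instance : DecidableEq TwoBA := inferInstanceAs (DecidableEq Bool)
instance : Fintype TwoBA := inferInstanceAs (Fintype Bool)

/-- The two-element Boolean algebra. -/
instance : agLang.Structure TwoBA where
  funMap f x :=
    match f, x with
    | AGFunc.join, x => (x 0 || x 1 : Bool)
    | AGFunc.meet, x => (x 0 && x 1 : Bool)
    | AGFunc.star, x => (!(x 0) : Bool)
    | AGFunc.prime, x => (!(x 0) : Bool)
    | AGFunc.zero, _ => false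
    | AGFunc.one, _ => true
  RelMap r _ := r.elim

lemma isBoolean_twoBA : IsBoolean TwoBA := by
  refine ⟨⟨?_, ?_, ?_, ?_, ?_, ?_, ?_, ?_, ?_⟩, ?_, ?_, ?_⟩ <;> decide

open Classical in
/-- The homomorphism to the two-element algebra given by a prime filter. -/
noncomputable def IsBoolean.hom {A : Type*} [agLang.Structure A] (h : IsBoolean A)
    {p : A → Prop} (hp : IsPrimeFilter p) : A →[agLang] TwoBA :=
  have hs : ∀ x, p (star x) ↔ ¬ p x := fun x => hp.compl_iff (h.join_star x) (h.meet_star x)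
  homOfOperations (fun x => (decide (p x) : Bool))
    (fun x y => show decide _ = (decide _ || decide _) by simp [hp.join_iff])
    (fun x y => show decide _ = (decide _ && decide _) by simp [hp.meet_iff])
    (fun x => show decide _ = !(decide _) by simp [hs])
    (fun x => show decide _ = !(decide _) by simp [h.prime_eq_star, hs])
    (show decide _ = false by simp [hp.zero_notMem])
    (show decide _ = true by simp [hp.one_mem])

lemma IsBoolean.separated {A : Type*} [agLang.Structure A] (h : IsBoolean A) :
    Separated TwoBA A := fun _ _ hxy =>
  h.lattice.eq_of_isPrimeFilter fun _ hp => decide_eq_decide.1 (hxy (h.hom hp))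

/-! #### Three-element chains -/

/-- The pseudocomplement of the three-element chain. -/
def chainStar (a : Fin 3) : Fin 3 := if a = 0 then 2 else 0

/-- The dual pseudocomplement of the three-element chain. -/
def chainDualStar (a : Fin 3) : Fin 3 := if a = 2 then 0 else 2

open Classical in
/-- The element of the three-element chain given by a pair of propositions. -/
noncomputable def toChain (a b : Prop) : Fin 3 := if a then 2 else if b then 1 else 0

/-- Pairs with `a → b` form a three-element chain under the coordinatewise order, so joins, meets
and equality are computed coordinatewise. -/
lemma toChain_or {a b c d : Prop} (h : a → b) (h' : c → d) :
    toChain (a ∨ c) (b ∨ d) = max (toChain a b) (toChain c d) := by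
  by_cases a <;> by_cases b <;> by_cases c <;> by_cases d <;> simp_all [toChain]

lemma toChain_and {a b c d : Prop} (h : a → b) (h' : c → d) :
    toChain (a ∧ c) (b ∧ d) = min (toChain a b) (toChain c d) := by
  by_cases a <;> by_cases b <;> by_cases c <;> by_cases d <;> simp_all [toChain]

lemma toChain_eq_iff {a b c d : Prop} (h : a → b) (h' : c → d) :
    toChain a b = toChain c d ↔ (a ↔ c) ∧ (b ↔ d) := by
  by_cases a <;> by_cases b <;> by_cases c <;> by_cases d <;> simp_all [toChain]

section Stone

variable {A : Type*} [agLang.Structure A] (h : IsStone A) {p : A → Prop} (hp : IsPrimeFilter p)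

include h hp

lemma IsStone.star_star_iff (x : A) : p (star (star x)) ↔ ¬ p (star x) :=
  hp.compl_iff (h.star_join_star_star x) (h.star_meet_star_star x)

lemma IsStone.imp_star_star {x : A} (hx : p x) : p (star (star x)) :=
  hp.mono (h.le_star_star x) hx

lemma IsStone.star_join_iff (x y : A) : p (star (join x y)) ↔ p (star x) ∧ p (star y) := by
  rw [h.star_join, hp.meet_iff]

/-- The axioms only give `(x ∧ y)**`; since `p` contains exactly one of `z*` and `z**`, negating
yields the law for `*`. -/
lemma IsStone.star_meet_iff (x y : A) : p (star (meet x y)) ↔ p (star x) ∨ p (star y) := by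
  have h1 := h.star_star_iff hp (meet x y)
  rw [h.star_star_meet, hp.meet_iff, h.star_star_iff hp, h.star_star_iff hp] at h1
  tauto

end Stone

/-- The universe of the three-element double Stone chain. -/
def ThreeDoubleStone : Type := Fin 3

instance : DecidableEq ThreeDoubleStone := inferInstanceAs (DecidableEq (Fin 3))
instance : Fintype ThreeDoubleStone := inferInstanceAs (Fintype (Fin 3))

/-- The three-element double Stone chain. -/
instance : agLang.Structure ThreeDoubleStone where
  funMap f x :=
    match f, x with
    | AGFunc.join, x => (max (x 0) (x 1) : Fin 3)
    | AGFunc.meet, x => (min (x 0) (x 1) : Fin 3)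
    | AGFunc.star, x => chainStar (x 0)
    | AGFunc.prime, x => chainDualStar (x 0)
    | AGFunc.zero, _ => (0 : Fin 3)
    | AGFunc.one, _ => (2 : Fin 3)
  RelMap r _ := r.elim

lemma isRegularDoubleStone_threeDoubleStone : IsRegularDoubleStone ThreeDoubleStone := by
  refine ⟨⟨⟨?_, ?_, ?_, ?_, ?_, ?_, ?_, ?_, ?_⟩, ?_, ?_, ?_, ?_, ?_, ?_, ?_⟩,
    ⟨⟨?_, ?_, ?_, ?_, ?_, ?_, ?_, ?_, ?_⟩, ?_, ?_, ?_, ?_, ?_, ?_, ?_⟩, ?_⟩ <;> decide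

section RegularDoubleStone

variable {A : Type*} [agLang.Structure A] (h : IsRegularDoubleStone A)
  {p : A → Prop} (hp : IsPrimeFilter p)

include h hp

lemma IsRegularDoubleStone.prime_prime_iff (x : A) : p (prime (prime x)) ↔ ¬ p (prime x) :=
  hp.compl_iff (h.dualStone.prime_join_prime_prime x) (h.dualStone.prime_meet_prime_prime x)

lemma IsRegularDoubleStone.of_prime_prime {x : A} (hx : p (prime (prime x))) : p x :=
  hp.mono (h.dualStone.prime_prime_le x) hx

lemma IsRegularDoubleStone.prime_prime_imp_star_star (x : A) (hx : p (prime (prime x))) :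
    p (star (star x)) :=
  h.stone.imp_star_star hp (h.of_prime_prime hp hx)

/-- The element `x*` is complemented by `x**`. Applying `''` to `x* ∨ x** = 1` puts `x*''` or
`x***''` style information into `p`: either `(x*)''` or `(x**)''` lies in `p`, and the latter is
below `x**`, which excludes `x*`. -/
lemma IsRegularDoubleStone.star_prime_prime_iff (x : A) :
    p (prime (prime (star x))) ↔ p (star x) := by
  refine ⟨h.of_prime_prime hp, fun hx => ?_⟩
  have h1 := hp.one_mem
  rw [← h.dualStone.prime_zero, ← h.dualStone.prime_one, ← h.stone.star_join_star_star x,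
    h.dualStone.prime_prime_join, hp.join_iff] at h1
  exact h1.resolve_right fun h2 =>
    (h.stone.star_star_iff hp x).1 (h.of_prime_prime hp h2) hx

lemma IsRegularDoubleStone.prime_star_star_iff (x : A) :
    p (star (star (prime x))) ↔ p (prime x) := by
  refine ⟨fun hx => ?_, h.stone.imp_star_star hp⟩
  have h0 := hp.zero_notMem
  rw [← h.stone.star_one, ← h.stone.star_zero, ← h.dualStone.prime_meet_prime_prime x,
    h.stone.star_star_meet, hp.meet_iff] at h0
  by_contra hn
  exact h0 ⟨hx, h.stone.imp_star_star hp ((h.prime_prime_iff hp x).2 hn)⟩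

/-- The homomorphism to the three-element double Stone chain given by a prime filter. -/
noncomputable def IsRegularDoubleStone.hom : A →[agLang] ThreeDoubleStone :=
  have hi := h.prime_prime_imp_star_star hp
  have hs := h.stone.star_star_iff hp
  have hq := h.prime_prime_iff hp
  -- Since `x'' ≤ x ≤ x**`, the value is top if `p` contains the lower approximation of `x`, bottom
  -- if it misses the upper one, and middle in between.
  homOfOperations (fun x => toChain (p (prime (prime x))) (p (star (star x))))
    (fun x y => by
      refine Eq.trans ?_ (toChain_or (hi x) (hi y))
      congr 1
      · rw [h.dualStone.prime_prime_join, hp.join_iff]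
      · rw [hs, hs, hs, h.stone.star_join_iff hp, not_and_or])
    (fun x y => by
      refine Eq.trans ?_ (toChain_and (hi x) (hi y))
      congr 1
      · rw [hq, hq, hq, h.dualStone.prime_meet, hp.join_iff, not_or]
      · rw [h.stone.star_star_meet, hp.meet_iff])
    (fun x => by
      change _ = chainStar (toChain _ _)
      have := hi x
      rw [h.star_prime_prime_iff hp, hs (star x), hs x, not_not]
      by_cases p (star x) <;> by_cases p (prime (prime x)) <;> simp_all [toChain, chainStar])
    (fun x => by
      change _ = chainDualStar (toChain _ _)
      have := hi x
      rw [h.prime_star_star_iff hp, hq (prime x), hq x, not_not]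
      by_cases p (star x) <;> by_cases p (prime x) <;> simp_all [toChain, chainDualStar])
    (by
      change _ = (0 : Fin 3)
      simp [toChain, h.dualStone.prime_zero, h.dualStone.prime_one, h.stone.star_zero,
        h.stone.star_one, hp.zero_notMem])
    (by
      change _ = (2 : Fin 3)
      simp [toChain, h.dualStone.prime_zero, h.dualStone.prime_one, hp.one_mem])

omit hp in
-- The homomorphism of `p` records only `x''` and `x**`. If these agree for `x` and `y` and `x ∈ p`,
-- then either `x'' ∈ p`, hence `y'' ∈ p` and `y ∈ p`, or `x ∧ x' ∈ p` and regularity gives `y ∨ y*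
-- ∈ p`, where `y*` is excluded by `y** ∈ p`.
lemma IsRegularDoubleStone.separated : Separated ThreeDoubleStone A := by
  have key : ∀ x y : A, (∀ f : A →[agLang] ThreeDoubleStone, f x = f y) →
      ∀ p : A → Prop, IsPrimeFilter p → p x → p y := by
    intro x y hxy p hp hx
    obtain ⟨h1, h2⟩ := (toChain_eq_iff (h.prime_prime_imp_star_star hp x)
      (h.prime_prime_imp_star_star hp y)).1 (hxy (h.hom hp))
    by_cases hxx : p (prime (prime x))
    · exact h.of_prime_prime hp (h1.1 hxx)
    · rw [h.prime_prime_iff hp, not_not] at hxx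
      refine ((hp.join_iff _ _).1 (hp.mono (h.regular x y)
        ((hp.meet_iff _ _).2 ⟨hx, hxx⟩))).resolve_right ?_
      exact (h.stone.star_star_iff hp y).1 (h2.1 (h.stone.imp_star_star hp hx))
  exact fun x y hxy => h.stone.lattice.eq_of_isPrimeFilter fun p hp =>
    ⟨key x y hxy p hp, key y x (fun f => (hxy f).symm) p hp⟩

end RegularDoubleStone

/-- The universe of the three-element Kleene Stone chain. -/
def ThreeKleeneStone : Type := Fin 3

instance : DecidableEq ThreeKleeneStone := inferInstanceAs (DecidableEq (Fin 3))
instance : Fintype ThreeKleeneStone := inferInstanceAs (Fintype (Fin 3))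

/-- The three-element Kleene Stone chain. -/
instance : agLang.Structure ThreeKleeneStone where
  funMap f x :=
    match f, x with
    | AGFunc.join, x => (max (x 0) (x 1) : Fin 3)
    | AGFunc.meet, x => (min (x 0) (x 1) : Fin 3)
    | AGFunc.star, x => chainStar (x 0)
    | AGFunc.prime, x => Fin.rev (n := 3) (x 0)
    | AGFunc.zero, _ => (0 : Fin 3)
    | AGFunc.one, _ => (2 : Fin 3)
  RelMap r _ := r.elim

lemma isRegularKleeneStone_threeKleeneStone : IsRegularKleeneStone ThreeKleeneStone := by
  refine ⟨⟨⟨?_, ?_, ?_, ?_, ?_, ?_, ?_, ?_, ?_⟩, ?_, ?_, ?_, ?_, ?_, ?_, ?_⟩,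
    ⟨⟨?_, ?_, ?_, ?_, ?_, ?_, ?_, ?_, ?_⟩, ?_, ?_, ?_, ?_, ?_⟩, ?_⟩ <;> decide

section RegularKleeneStone

variable {A : Type*} [agLang.Structure A] (h : IsRegularKleeneStone A)
  {p : A → Prop} (hp : IsPrimeFilter p)

include h

lemma IsRegularKleeneStone.prime_join (x y : A) :
    prime (join x y) = meet (prime x) (prime y) := by
  rw [← h.kleene.prime_prime (meet (prime x) (prime y)), h.kleene.prime_meet,
    h.kleene.prime_prime, h.kleene.prime_prime]

/-- A prime filter contains exactly one of `x*`, `x**` and exactly one of their images under `'`.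
The Kleene inequality forbids it to contain both an element and its image while missing the other
pair. -/
lemma IsRegularKleeneStone.prime_star (x : A) : prime (star x) = star (star x) := by
  refine h.stone.lattice.eq_of_isPrimeFilter fun p hp => ?_
  have h1 := hp.one_mem
  have h0 := hp.zero_notMem
  rw [← h.kleene.prime_zero, ← h.stone.star_meet_star_star x, h.kleene.prime_meet,
    hp.join_iff] at h1
  rw [← h.kleene.prime_one, ← h.stone.star_join_star_star x, h.prime_join, hp.meet_iff] at h0
  have h2 := hp.mono (h.kleene.kleene (star x) (star (star x)))
  have h3 := hp.mono (h.kleene.kleene (star (star x)) (star x))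
  rw [hp.meet_iff, hp.join_iff] at h2 h3
  have := h.stone.star_star_iff hp x
  tauto

include hp

lemma IsRegularKleeneStone.of_prime_star {x : A} (hx : p (star (prime x))) : p x := by
  -- Applying `'` to `x' ≤ x'**` gives `x'**' ≤ x`, and `x'**'` lies in `p` exactly when `x'*` does.
  have h1 : join x (prime (star (star (prime x)))) = x := by
    have := congrArg prime (h.stone.le_star_star (prime x))
    rwa [h.kleene.prime_meet, h.kleene.prime_prime] at this
  rw [← h1, hp.join_iff, h.prime_star, h.stone.star_star_iff hp, h.stone.star_star_iff hp, not_not]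
  exact .inr hx

lemma IsRegularKleeneStone.prime_star_imp_star_star (x : A) (hx : p (star (prime x))) :
    p (star (star x)) :=
  h.stone.imp_star_star hp (h.of_prime_star hp hx)

/-- The homomorphism to the three-element Kleene Stone chain given by a prime filter. -/
noncomputable def IsRegularKleeneStone.hom : A →[agLang] ThreeKleeneStone :=
  have hi := h.prime_star_imp_star_star hp
  have hs := h.stone.star_star_iff hp
  -- Here `x'*` is the lower approximation of `x`, in the role of `x''` for double Stone algebras.
  homOfOperations (fun x => toChain (p (star (prime x))) (p (star (star x))))
    (fun x y => by
      refine Eq.trans ?_ (toChain_or (hi x) (hi y))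
      congr 1
      · rw [h.prime_join, h.stone.star_meet_iff hp]
      · rw [hs, hs, hs, h.stone.star_join_iff hp, not_and_or])
    (fun x y => by
      refine Eq.trans ?_ (toChain_and (hi x) (hi y))
      congr 1
      · rw [h.kleene.prime_meet, h.stone.star_join_iff hp]
      · rw [h.stone.star_star_meet, hp.meet_iff])
    (fun x => by
      change _ = chainStar (toChain _ _)
      have := hi x
      rw [h.prime_star, hs (star x), hs x, not_not]
      by_cases p (star x) <;> by_cases p (star (prime x)) <;> simp_all [toChain, chainStar])
    (fun x => by
      change _ = Fin.rev (n := 3) (toChain _ _)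
      have := hi x
      rw [h.kleene.prime_prime, hs (prime x), hs x]
      by_cases p (star x) <;> by_cases p (star (prime x)) <;> simp_all [toChain])
    (by
      change _ = (0 : Fin 3)
      simp [toChain, h.kleene.prime_zero, h.stone.star_zero, h.stone.star_one, hp.zero_notMem])
    (by
      change _ = (2 : Fin 3)
      simp [toChain, h.kleene.prime_one, h.stone.star_zero, hp.one_mem])

omit hp in
lemma IsRegularKleeneStone.separated : Separated ThreeKleeneStone A := by
  have key : ∀ x y : A, (∀ f : A →[agLang] ThreeKleeneStone, f x = f y) →
      ∀ p : A → Prop, IsPrimeFilter p → p x → p y := by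
    intro x y hxy p hp hx
    obtain ⟨h1, h2⟩ := (toChain_eq_iff (h.prime_star_imp_star_star hp x)
      (h.prime_star_imp_star_star hp y)).1 (hxy (h.hom hp))
    by_cases hxx : p (star (prime x))
    · exact h.of_prime_star hp (h1.1 hxx)
    · rw [← h.stone.star_star_iff hp, ← h.prime_star] at hxx
      refine ((hp.join_iff _ _).1 (hp.mono (h.regular x y)
        ((hp.meet_iff _ _).2 ⟨hx, hxx⟩))).resolve_right ?_
      exact (h.stone.star_star_iff hp y).1 (h2.1 (h.stone.imp_star_star hp hx))
  exact fun x y hxy => h.stone.lattice.eq_of_isPrimeFilter fun p hp =>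
    ⟨key x y hxy p hp, key y x (fun f => (hxy f).symm) p hp⟩

end RegularKleeneStone

/-! #### De Morgan Boolean algebras -/

instance : DecidableEq FourDMBA := inferInstanceAs (DecidableEq (Bool × Bool))
instance : Fintype FourDMBA := inferInstanceAs (Fintype (Bool × Bool))

lemma isDeMorganBoolean_fourDMBA : IsDeMorganBoolean FourDMBA := by
  refine ⟨⟨?_, ?_, ?_, ?_, ?_, ?_, ?_, ?_, ?_⟩, ?_, ?_, ?_, ?_, ?_, ?_, ?_, ?_⟩ <;> decide

open Classical in
/-- The homomorphism to the four-element algebra given by a prime filter. -/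
noncomputable def IsDeMorganBoolean.hom {A : Type*} [agLang.Structure A]
    (h : IsDeMorganBoolean A) {p : A → Prop} (hp : IsPrimeFilter p) : A →[agLang] FourDMBA :=
  have hs : ∀ x, p (star x) ↔ ¬ p x := fun x => hp.compl_iff (h.join_star x) (h.meet_star x)
  -- The second coordinate belongs to the prime filter `{x | x' ∉ p}`; `'` exchanges the two filters
  -- up to complement.
  homOfOperations (fun x => (decide (p x), !decide (p (prime x))))
    (fun x y => by
      change _ = (decide _ || decide _, !decide _ || !decide _)
      simp [hp.join_iff, hp.meet_iff, h.prime_join])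
    (fun x y => by
      change _ = (decide _ && decide _, !decide _ && !decide _)
      simp [hp.join_iff, hp.meet_iff, h.prime_meet])
    (fun x => by
      change _ = (!decide _, !!decide _)
      simp [hs, h.prime_star])
    (fun x => by
      change _ = (!!decide _, !decide _)
      simp [h.prime_prime])
    (by
      change _ = (false, false)
      simp [hp.zero_notMem, hp.one_mem, h.prime_zero])
    (by
      change _ = (true, true)
      simp [hp.zero_notMem, hp.one_mem, h.prime_one])

lemma IsDeMorganBoolean.separated {A : Type*} [agLang.Structure A] (h : IsDeMorganBoolean A) :
    Separated FourDMBA A := fun _ _ hxy =>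
  h.lattice.eq_of_isPrimeFilter fun _ hp =>
    decide_eq_decide.1 (congrArg Prod.fst (hxy (h.hom hp)))

/-! ### Algebras represented over a finite algebra with a generating parameter -/

section Template

variable {P : Type*} [agLang.Structure P]

/-- `P` is generated by `p₀`, which satisfies the equations `x* = s(x)`, `x' = t(x)`; all other
solutions are moved to `p₀` by an injective endomorphism. With the parameter `p₀`, the
characteristic functions of the points of `P` are term functions, and `0` and `1` are the only
elements with `x* = x'`. -/
structure IsTemplate (p₀ : P) (s t : agLang.Term (Fin 1)) : Prop where
  one_meet : ∀ p : P, meet (one P) p = p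
  zero_meet : ∀ p : P, meet (zero P) p = zero P
  join_zero : ∀ p : P, join p (zero P) = p
  zero_join : ∀ p : P, join (zero P) p = p
  star_zero : star (zero P) = one P
  star_one : star (one P) = zero P
  zero_ne_one : zero P ≠ one P
  star_eq_prime_iff : ∀ p : P, star p = prime p ↔ p = zero P ∨ p = one P
  exists_const : ∀ p : P, ∃ r : agLang.Term (Fin 1), r.realize (fun _ => p₀) = p
  exists_char : ∀ p : P, ∃ r : agLang.Term (Fin 2), ∀ q : P,
    (q = p → r.realize ![q, p₀] = one P) ∧ (q ≠ p → r.realize ![q, p₀] = zero P)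
  star_param : star p₀ = s.realize fun _ => p₀
  prime_param : prime p₀ = t.realize fun _ => p₀
  exists_hom : ∀ p : P, (star p = s.realize fun _ => p) → (prime p = t.realize fun _ => p) →
    ∃ e : P →[agLang] P, Function.Injective e ∧ e p = p₀

variable {A : Type*} [agLang.Structure A]

variable (A) in
/-- The elements with `x* = x'` form an atomless Boolean algebra. -/
def HasAtomlessCenter : Prop :=
  ∀ d : A, star d = prime d → d ≠ zero A →
    ∃ e : A, star e = prime e ∧ meet e d = e ∧ e ≠ zero A ∧ e ≠ d

/-- Homomorphisms to `P` that send `c` to `p₀`. -/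
abbrev Point (c : A) (p₀ : P) : Type _ := {h : A →[agLang] P // h c = p₀}

/-- The set `U` of points is the support of an element with values in `{0, 1}`. -/
def IsClopenSet {c : A} {p₀ : P} (U : Set (Point c p₀)) : Prop :=
  ∃ d : A, ∀ h : Point c p₀, (h ∈ U → h.1 d = one P) ∧ (h ∉ U → h.1 d = zero P)

variable {p₀ : P} {s t : agLang.Term (Fin 1)} (T : IsTemplate p₀ s t) {c : A}

include T

/-- Any homomorphism to `P` sends `c` to a solution of the parameter equations. Composing with an
injective endomorphism makes it a point without identifying more elements. -/
lemma IsTemplate.separated_point (hA : Separated P A) (hs : star c = s.realize fun _ => c)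
    (ht : prime c = t.realize fun _ => c) {x y : A} (hxy : ∀ h : Point c p₀, h.1 x = h.1 y) :
    x = y := by
  refine hA x y fun h => ?_
  obtain ⟨e, he, hc⟩ := T.exists_hom (h c)
    (by rw [← map_star, hs]; exact (HomClass.realize_term h).symm)
    (by rw [← map_prime, ht]; exact (HomClass.realize_term h).symm)
  exact he (hxy ⟨e.comp h, hc⟩)

lemma IsTemplate.exists_eq_const (c : A) (p : P) : ∃ a : A, ∀ h : Point c p₀, h.1 a = p := by
  obtain ⟨r, hr⟩ := T.exists_const p
  refine ⟨r.realize fun _ => c, fun h => ?_⟩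
  rw [← HomClass.realize_term, ← hr]
  exact congrArg (fun v => r.realize v) (funext fun _ => h.2)

lemma IsTemplate.exists_glue {U : Set (Point c p₀)} (hU : IsClopenSet U) (a b : A) :
    ∃ x : A, ∀ h : Point c p₀, (h ∈ U → h.1 x = h.1 a) ∧ (h ∉ U → h.1 x = h.1 b) := by
  obtain ⟨d, hd⟩ := hU
  -- Definition by cases: `a` where `d` is 1, `b` where `d` is 0.
  refine ⟨join (meet d a) (meet (star d) b), fun h => ⟨fun hh => ?_, fun hh => ?_⟩⟩
  · rw [map_join, map_meet, map_meet, map_star, (hd h).1 hh, T.star_one, T.one_meet, T.zero_meet,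
      T.join_zero]
  · rw [map_join, map_meet, map_meet, map_star, (hd h).2 hh, T.star_zero, T.one_meet, T.zero_meet,
      T.zero_join]

omit T in
lemma isClopenSet_univ : IsClopenSet (Set.univ : Set (Point c p₀)) :=
  ⟨one A, fun h => ⟨fun _ => map_one h.1, fun hh => (hh trivial).elim⟩⟩

lemma IsTemplate.isClopenSet_inter {U V : Set (Point c p₀)} (hU : IsClopenSet U)
    (hV : IsClopenSet V) : IsClopenSet (U ∩ V) := by
  obtain ⟨d, hd⟩ := hV
  obtain ⟨x, hx⟩ := T.exists_glue hU d (zero A)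
  refine ⟨x, fun h => ⟨fun hh => ?_, fun hh => ?_⟩⟩
  · rw [(hx h).1 hh.1, (hd h).1 hh.2]
  · by_cases hhU : h ∈ U
    · rw [(hx h).1 hhU, (hd h).2 fun hV => hh ⟨hhU, hV⟩]
    · rw [(hx h).2 hhU, map_zero]

lemma IsTemplate.isClopenSet_eq (x : A) (p : P) :
    IsClopenSet {h : Point c p₀ | h.1 x = p} := by
  obtain ⟨r, hr⟩ := T.exists_char p
  have key : ∀ h : Point c p₀, h.1 (r.realize ![x, c]) = r.realize ![h.1 x, p₀] := by
    intro h
    rw [← HomClass.realize_term]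
    refine congrArg (fun v => r.realize v) (funext fun i => ?_)
    fin_cases i
    exacts [rfl, h.2]
  exact ⟨r.realize ![x, c], fun h => by rw [key]; exact hr (h.1 x)⟩

lemma IsTemplate.isClopenSet_forall_eq {ι : Type*} [Finite ι] (x : ι → A) (η : ι → P) :
    IsClopenSet {h : Point c p₀ | ∀ i, h.1 (x i) = η i} := by
  classical
  have := Fintype.ofFinite ι
  have key : ∀ S : Finset ι, IsClopenSet {h : Point c p₀ | ∀ i ∈ S, h.1 (x i) = η i} := by
    intro S
    induction S using Finset.induction_on with
    | empty => simpa using isClopenSet_univ (p₀ := p₀) (c := c)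
    | insert i S _ ih =>
      convert T.isClopenSet_inter (T.isClopenSet_eq (x i) (η i)) ih using 1
      ext h
      simp
  simpa using key Finset.univ

lemma IsTemplate.exists_glue_of_finite {ι : Type*} [Finite ι] (g : Point c p₀ → ι)
    (hg : ∀ i, IsClopenSet {h | g h = i}) (b : ι → A) :
    ∃ x : A, ∀ h : Point c p₀, h.1 x = h.1 (b (g h)) := by
  classical
  have := Fintype.ofFinite ι
  have key : ∀ S : Finset ι, ∃ x : A, ∀ h : Point c p₀, g h ∈ S → h.1 x = h.1 (b (g h)) := by
    intro S
    induction S using Finset.induction_on with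
    | empty => exact ⟨zero A, by simp⟩
    | insert i S _ ih =>
      obtain ⟨x, hx⟩ := ih
      obtain ⟨y, hy⟩ := T.exists_glue (hg i) (b i) x
      refine ⟨y, fun h hh => ?_⟩
      by_cases hi : g h = i
      · rw [(hy h).1 hi, hi]
      · rw [(hy h).2 hi, hx h (Finset.mem_of_mem_insert_of_ne hh hi)]
  obtain ⟨x, hx⟩ := key Finset.univ
  exact ⟨x, fun h => hx h (Finset.mem_univ _)⟩

variable (hsep : ∀ x y : A, (∀ h : Point c p₀, h.1 x = h.1 y) → x = y)
  (hA : HasAtomlessCenter A)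

include hsep hA

/-- The element supported on `U` is central and nonzero; a central element strictly between 0 and it
has as support a proper nonempty part of `U`. -/
lemma IsTemplate.exists_split {U : Set (Point c p₀)} (hU : IsClopenSet U) (hne : U.Nonempty) :
    ∃ V, IsClopenSet V ∧ V ⊆ U ∧ V.Nonempty ∧ (U \ V).Nonempty := by
  obtain ⟨d, hd⟩ := hU
  have hd01 : ∀ h : Point c p₀, h.1 d = zero P ∨ h.1 d = one P := fun h => by
    by_cases hh : h ∈ U
    exacts [.inr ((hd h).1 hh), .inl ((hd h).2 hh)]
  obtain ⟨h₀, hh₀⟩ := hne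
  have hd0 : d ≠ zero A := fun h0 => T.zero_ne_one (by
    rw [← (hd h₀).1 hh₀, h0, map_zero])
  obtain ⟨e, he, hed, he0, hne⟩ := hA d (hsep _ _ fun h => by
    rw [map_star, map_prime]; exact (T.star_eq_prime_iff _).2 (hd01 h)) hd0
  have he01 : ∀ h : Point c p₀, h.1 e = zero P ∨ h.1 e = one P := fun h =>
    (T.star_eq_prime_iff _).1 (by rw [← map_star, ← map_prime, he])
  have hsub : ∀ h : Point c p₀, h.1 e = one P → h ∈ U := fun h h1 => by
    by_contra hh
    have := congrArg h.1 hed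
    rw [map_meet, h1, T.one_meet, (hd h).2 hh] at this
    exact T.zero_ne_one this
  refine ⟨{h | h.1 e = one P}, T.isClopenSet_eq _ _, hsub, ?_, ?_⟩
  · by_contra hn
    refine he0 (hsep _ _ fun h => ?_)
    rw [map_zero]
    exact (he01 h).resolve_right fun h1 => hn ⟨h, h1⟩
  · by_contra hn
    refine hne (hsep _ _ fun h => ?_)
    by_cases h1 : h.1 e = one P
    · rw [h1, (hd h).1 (hsub h h1)]
    · rw [(he01 h).resolve_right h1, (hd h).2 fun hh => hn ⟨h, hh, h1⟩]

/-- Each further value of `S` is taken on a piece split off from `U`, and the remaining values are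
realised on the other piece. -/
lemma IsTemplate.exists_image_eq {U : Set (Point c p₀)} (hU : IsClopenSet U) (hne : U.Nonempty)
    {S : Set P} (hS : S.Finite) (hSne : S.Nonempty) :
    ∃ b : A, ∀ p, p ∈ S ↔ ∃ h ∈ U, h.1 b = p := by
  induction S, hS using Set.Finite.induction_on generalizing U with
  | empty => exact (Set.not_nonempty_empty hSne).elim
  | @insert p S hpS _ ih =>
    obtain rfl | hS' := S.eq_empty_or_nonempty
    · obtain ⟨a, ha⟩ := T.exists_eq_const c p
      obtain ⟨h, hh⟩ := hne
      refine ⟨a, fun q => ⟨fun hq => ⟨h, hh, ?_⟩, ?_⟩⟩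
      · rw [ha, show q = p by simpa using hq]
      · rintro ⟨h, -, rfl⟩
        simp [ha]
    · obtain ⟨V, hV, hVU, hVne, hUV⟩ := T.exists_split hsep hA hU hne
      obtain ⟨b, hb⟩ := ih hV hVne hS'
      obtain ⟨a, ha⟩ := T.exists_eq_const c p
      obtain ⟨x, hx⟩ := T.exists_glue hV b a
      refine ⟨x, fun q => ⟨?_, ?_⟩⟩
      · rintro (rfl | hq)
        · obtain ⟨h, hh, hhV⟩ := hUV
          exact ⟨h, hh, by rw [(hx h).2 hhV, ha]⟩
        · obtain ⟨h, hh, rfl⟩ := (hb q).1 hq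
          exact ⟨h, hVU hh, (hx h).1 hh⟩
      · rintro ⟨h, hh, rfl⟩
        by_cases hhV : h ∈ V
        · exact .inr ((hb _).2 ⟨h, hhV, ((hx h).1 hhV).symm⟩)
        · exact .inl (by rw [(hx h).2 hhV, ha])

/-- The patterns of `x` partition the points into finitely many clopen sets. The prescribed values
are realised on each nonempty one separately, and the results are glued. -/
lemma IsTemplate.exists_extension [Finite P] {ι : Type*} [Finite ι] (x : ι → A)
    (S : (ι → P) → Set P)
    (hS : ∀ η, (S η).Nonempty ↔ ∃ h : Point c p₀, h.1 ∘ x = η) :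
    ∃ a : A, ∀ η p, p ∈ S η ↔ ∃ h : Point c p₀, h.1 ∘ x = η ∧ h.1 a = p := by
  have hclopen : ∀ η : ι → P, IsClopenSet {h : Point c p₀ | h.1 ∘ x = η} := fun η => by
    simpa only [funext_iff, Function.comp_apply] using T.isClopenSet_forall_eq x η
  have key : ∀ η : ι → P, ∃ b : A, ∀ p, p ∈ S η ↔ ∃ h : Point c p₀, h.1 ∘ x = η ∧ h.1 b = p := by
    intro η
    by_cases hη : ∃ h : Point c p₀, h.1 ∘ x = η
    · exact T.exists_image_eq hsep hA (hclopen η) hη (Set.toFinite _) ((hS η).2 hη)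
    · refine ⟨zero A, fun p => ⟨fun hp => (hη ((hS η).1 ⟨p, hp⟩)).elim, ?_⟩⟩
      rintro ⟨h, hh, -⟩
      exact (hη ⟨h, hh⟩).elim
  choose b hb using key
  obtain ⟨a, ha⟩ := T.exists_glue_of_finite (fun h : Point c p₀ => h.1 ∘ x) hclopen b
  refine ⟨a, fun η p => (hb η p).trans (exists_congr fun h => and_congr_right fun hh => ?_)⟩
  rw [ha h, hh]

end Template

/-! ### Back and forth -/

section BackAndForth

variable {P : Type*} [agLang.Structure P] {p₀ : P} {s t : agLang.Term (Fin 1)}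
  {A B : Type*} [agLang.Structure A] [agLang.Structure B] {c : A} {d : B}

/-- The tuples `x` and `y` have the same images under the points of `A` and `B`. -/
def SameType (c : A) (d : B) (p₀ : P) {ι : Type*} (x : ι → A) (y : ι → B) : Prop :=
  ∀ η : ι → P, (∃ h : Point c p₀, h.1 ∘ x = η) ↔ ∃ k : Point d p₀, k.1 ∘ y = η

lemma SameType.symm {ι : Type*} {x : ι → A} {y : ι → B} (h : SameType c d p₀ x y) :
    SameType d c p₀ y x := fun η => (h η).symm

/-- An equation between terms is tested at the points, where it depends only on the pattern of the
tuple. -/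
lemma SameType.realize_eq {ι : Type*} {x : ι → A} {y : ι → B} (hxy : SameType c d p₀ x y)
    (hB : ∀ a b : B, (∀ h : Point d p₀, h.1 a = h.1 b) → a = b)
    {q r : agLang.Term ι} (h : q.realize x = r.realize x) : q.realize y = r.realize y := by
  refine hB _ _ fun k => ?_
  obtain ⟨l, hl⟩ := (hxy _).2 ⟨k, rfl⟩
  rw [← HomClass.realize_term, ← HomClass.realize_term, ← hl, HomClass.realize_term,
    HomClass.realize_term, h]

lemma comp_sumElim_snoc_eq_iff {α C D : Type*} {n : ℕ} (l : C → D) (v : α → C) (x : Fin n → C)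
    (a : C) (η : α ⊕ Fin (n + 1) → D) :
    l ∘ Sum.elim v (Fin.snoc x a : Fin (n + 1) → C) = η ↔
      l ∘ Sum.elim v x = η ∘ Sum.map id Fin.castSucc ∧ l a = η (.inr (Fin.last n)) := by
  simp [funext_iff, Fin.forall_fin_succ', and_assoc]

lemma IsTemplate.exists_sameType_snoc [Finite P] (T : IsTemplate p₀ s t)
    (hB : ∀ a b : B, (∀ h : Point d p₀, h.1 a = h.1 b) → a = b) (hB' : HasAtomlessCenter B)
    {α : Type*} [Finite α] {n : ℕ} {v : α → A} {w : α → B} {x : Fin n → A} {y : Fin n → B}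
    (h : SameType c d p₀ (Sum.elim v x) (Sum.elim w y)) (a : A) :
    ∃ b : B, SameType c d p₀ (Sum.elim v (Fin.snoc x a : Fin (n + 1) → A))
      (Sum.elim w (Fin.snoc y b : Fin (n + 1) → B)) := by
  obtain ⟨b, hb⟩ := T.exists_extension hB hB' (Sum.elim w y)
    -- The values that `a` takes on each pattern, to be imitated in `B`.
    (fun η => {p | ∃ l : Point c p₀, l.1 ∘ Sum.elim v x = η ∧ l.1 a = p}) (fun η => by
      rw [← h η]
      exact ⟨fun ⟨_, l, hl, _⟩ => ⟨l, hl⟩, fun ⟨l, hl⟩ => ⟨_, l, hl, rfl⟩⟩)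
  refine ⟨b, fun η => ?_⟩
  simp only [comp_sumElim_snoc_eq_iff]
  exact hb _ _

lemma IsTemplate.realize_iff [Finite P] (T : IsTemplate p₀ s t)
    (hA : ∀ a b : A, (∀ h : Point c p₀, h.1 a = h.1 b) → a = b) (hA' : HasAtomlessCenter A)
    (hB : ∀ a b : B, (∀ h : Point d p₀, h.1 a = h.1 b) → a = b) (hB' : HasAtomlessCenter B)
    {α : Type*} [Finite α] {n : ℕ} (φ : agLang.BoundedFormula α n)
    {v : α → A} {w : α → B} {x : Fin n → A} {y : Fin n → B}
    (h : SameType c d p₀ (Sum.elim v x) (Sum.elim w y)) : φ.Realize v x ↔ φ.Realize w y := by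
  induction φ with
  | falsum => exact Iff.rfl
  | equal q r => exact ⟨h.realize_eq hB, h.symm.realize_eq hA⟩
  | rel R _ => exact R.elim
  | imp φ ψ hφ hψ => exact imp_congr (hφ h) (hψ h)
  | all φ ih =>
    refine ⟨fun hx b => ?_, fun hy a => ?_⟩
    · obtain ⟨a, ha⟩ := T.exists_sameType_snoc hA hA' h.symm b
      exact (ih ha.symm).1 (hx a)
    · obtain ⟨b, hb⟩ := T.exists_sameType_snoc hB hB' h a
      exact (ih hb).2 (hy b)

end BackAndForth

/-- The parameter `c` of `S` serves `B` as well, so only equality of patterns is at stake. Points of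
`B` restrict to `S`; conversely a pattern occurring in `S` is named by a nonzero element of `S`,
which some point of `B` detects. -/
lemma IsTemplate.isElementary {P : Type*} [agLang.Structure P] [Finite P] {p₀ : P}
    {s t : agLang.Term (Fin 1)} (T : IsTemplate p₀ s t) {B : Type*} [agLang.Structure B]
    (S : agLang.Substructure B) (hB : Separated P B) (hS : Separated P S)
    (hB' : HasAtomlessCenter B) (hS' : HasAtomlessCenter S) {c : S}
    (hs : star c = s.realize fun _ => c) (ht : prime c = t.realize fun _ => c) :
    S.IsElementary := by
  intro n φ x
  have hsepS := fun a b => T.separated_point (x := a) (y := b) hS hs ht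
  have hsepB := fun a b => T.separated_point (c := (c : B)) (x := a) (y := b) hB
    ((map_star S.subtype c).symm.trans (by
      rw [hs]; exact (HomClass.realize_term S.subtype).symm))
    ((map_prime S.subtype c).symm.trans (by
      rw [ht]; exact (HomClass.realize_term S.subtype).symm))
  let restrict : Point (c : B) p₀ → Point c p₀ := fun h => ⟨h.1.comp S.subtype.toHom, h.2⟩
  refine T.realize_iff hsepB hB' hsepS hS' φ fun η => ⟨?_, ?_⟩
  · rintro ⟨h, rfl⟩
    refine ⟨restrict h, funext fun i => ?_⟩
    rcases i with i | i
    exacts [rfl, i.elim0]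
  · rintro ⟨k, hk⟩
    -- The point `k` itself need not extend to `B`. Any point of `B` not vanishing at `d` restricts
    -- to one with the pattern `η`.
    obtain ⟨d, hd⟩ := T.isClopenSet_forall_eq (c := c) (Sum.elim x default) η
    have hd0 : (d : B) ≠ zero B := by
      intro h0
      have hd0 : d = zero S := Subtype.ext (h0.trans (map_zero S.subtype).symm)
      have := (hd k).1 fun i => congrFun hk i
      rw [hd0, map_zero] at this
      exact T.zero_ne_one this
    obtain ⟨h, hh⟩ : ∃ h : Point (c : B) p₀, h.1 d ≠ zero P := by
      by_contra! hn
      exact hd0 (hsepB _ _ fun h => by rw [hn, map_zero])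
    refine ⟨h, funext fun i => ?_⟩
    have := not_not.1 (mt (hd (restrict h)).2 hh) i
    rcases i with i | i
    exacts [this, i.elim0]

/-! ### Embedding into algebras with an atomless center -/

section Power

variable (X : Type u) (P : Type) [agLang.Structure P]

/-- The functions `X × (ℕ → Bool) → P` that depend on only finitely many of the coordinates
in `ℕ`. -/
def finitaryPower : agLang.Substructure (X × (ℕ → Bool) → P) where
  carrier := {f | ∃ n : ℕ, ∀ x (a b : ℕ → Bool), (∀ i < n, a i = b i) → f (x, a) = f (x, b)}
  fun_mem {k} F f hf := by
    choose n hn using hf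
    refine ⟨Finset.univ.sup n, fun x a b hab => ?_⟩
    refine congrArg (Structure.funMap F) (funext fun i => hn i x a b fun j hj => hab j ?_)
    exact hj.trans_le (Finset.le_sup (Finset.mem_univ i))

variable {X P}

lemma mem_finitaryPower {f : X × (ℕ → Bool) → P} :
    f ∈ finitaryPower X P ↔
      ∃ n : ℕ, ∀ x (a b : ℕ → Bool), (∀ i < n, a i = b i) → f (x, a) = f (x, b) := Iff.rfl

/-- Evaluation of a function at a point, as a homomorphism. -/
def evalHom (z : X × (ℕ → Bool)) : finitaryPower X P →[agLang] P where
  toFun f := f.1 z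
  map_fun' _ _ := rfl
  map_rel' r _ := r.elim

lemma finitaryPower_ext {f g : finitaryPower X P} (h : ∀ z, evalHom z f = evalHom z g) : f = g :=
  Subtype.ext (funext h)

lemma separated_finitaryPower : Separated P (finitaryPower X P) :=
  fun _ _ h => finitaryPower_ext fun z => h (evalHom z)

variable {p₀ : P} {s t : agLang.Term (Fin 1)} (T : IsTemplate p₀ s t)

include T

lemma IsTemplate.exists_param_finitaryPower :
    ∃ c : finitaryPower X P, (star c = s.realize fun _ => c) ∧
      prime c = t.realize fun _ => c := by
  refine ⟨⟨fun _ => p₀, 0, fun _ _ _ _ => rfl⟩, finitaryPower_ext fun z => ?_,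
    finitaryPower_ext fun z => ?_⟩
  · rw [map_star, ← HomClass.realize_term]
    exact T.star_param
  · rw [map_prime, ← HomClass.realize_term]
    exact T.prime_param

lemma IsTemplate.hasAtomlessCenter_finitaryPower : HasAtomlessCenter (finitaryPower X P) := by
  classical
  intro d hd hd0
  have hd01 : ∀ z, d.1 z = zero P ∨ d.1 z = one P := fun z => by
    have := congrArg (evalHom z) hd
    rw [map_star, map_prime] at this
    exact (T.star_eq_prime_iff _).1 this
  obtain ⟨⟨x, a⟩, hxa⟩ : ∃ z, d.1 z = one P := by
    by_contra! hn
    refine hd0 (finitaryPower_ext fun z => ?_)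
    rw [map_zero]
    exact (hd01 z).resolve_right (hn z)
  obtain ⟨n, hn⟩ := mem_finitaryPower.1 d.2
  have hupd : ∀ v : Bool, d.1 (x, Function.update a n v) = one P := fun v => by
    rw [← hxa]
    exact hn _ _ _ fun i hi => Function.update_of_ne hi.ne _ _
  -- Since `d` depends only on coordinates below `n`, coordinate `n` is free; `e` keeps the half of
  -- `d` where it is true.
  let e : finitaryPower X P := ⟨fun z => if z.2 n then d.1 z else zero P, n + 1, fun y b b' h => by
    simp only [h n n.lt_succ_self, hn y b b' fun i hi => h i (hi.trans n.lt_succ_self)]⟩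
  have he : ∀ z, evalHom z e = if z.2 n then d.1 z else zero P := fun z => rfl
  refine ⟨e, finitaryPower_ext fun z => ?_, finitaryPower_ext fun z => ?_, fun h => ?_, fun h => ?_⟩
  · rw [map_star, map_prime, T.star_eq_prime_iff, he]
    split_ifs
    exacts [hd01 z, .inl rfl]
  · rw [map_meet, he]
    change meet _ (d.1 z) = _
    split_ifs
    · obtain h0 | h1 := hd01 z
      · rw [h0, T.zero_meet]
      · rw [h1, T.one_meet]
    · rw [T.zero_meet]
  · have := congrArg (evalHom (x, Function.update a n true)) h
    rw [map_zero, he] at this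
    simp only [Function.update_self, if_true, hupd] at this
    exact T.zero_ne_one this.symm
  · have := congrArg (evalHom (x, Function.update a n false)) h
    rw [he] at this
    simp only [Function.update_self, Bool.false_eq_true, if_false] at this
    exact T.zero_ne_one (this.trans (hupd false))

omit T in
lemma Separated.exists_embedding {A : Type u} [agLang.Structure A] (hA : Separated P A) :
    Nonempty (A ↪[agLang] finitaryPower (A →[agLang] P) P) :=
  ⟨embeddingOfInjective
    { toFun := fun x => ⟨fun z => z.1 x, 0, fun _ _ _ _ => rfl⟩
      map_fun' := fun F x => Subtype.ext (funext fun z => HomClass.map_fun z.1 F x)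
      map_rel' := fun r _ => r.elim }
    -- The image functions ignore the Cantor coordinate, so any sequence would do.
    fun x y hxy => hA x y fun h => congrFun (congrArg Subtype.val hxy) (h, fun _ => false)⟩

end Power

/-! ### The model companion -/

/-- The sentence that says that the equations `x* = s(x)`, `x' = t(x)` have a common solution and
the elements with `x* = x'` form an atomless Boolean algebra. -/
def companionSentence (s t : agLang.Term (Fin 1)) : agLang.Sentence :=
  (∃' ((starTerm (&0) =' s.relabel Sum.inr) ⊓ (primeTerm (&0) =' t.relabel Sum.inr))) ⊓
  ∀' ((starTerm (&0) =' primeTerm (&0)) ⟹ ∼(&0 =' zeroTerm) ⟹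
    ∃' ((starTerm (&1) =' primeTerm (&1)) ⊓ ((meetTerm (&1) (&0) =' &1) ⊓
      (∼(&1 =' zeroTerm) ⊓ ∼(&1 =' &0)))))

lemma realize_companionSentence {A : Type*} [agLang.Structure A] (s t : agLang.Term (Fin 1)) :
    A ⊨ companionSentence s t ↔
      (∃ c : A, (star c = s.realize fun _ => c) ∧ prime c = t.realize fun _ => c) ∧
      HasAtomlessCenter A := by
  have h : ∀ (x : A) (v : Empty → A), Sum.elim v (Fin.snoc default x) ∘ (Sum.inr : Fin 1 → _) =
      fun _ => x := fun x v => funext fun i => by simp [Fin.snoc]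
  simp [companionSentence, Sentence.Realize, Formula.Realize, HasAtomlessCenter, h, Fin.snoc]

/-- The class `K` is given by identities and one sentence, so models of `Th K` lie in `K`. These
already belong to `V`; the other embedding goes into a finitary power of `P`. -/
theorem IsTemplate.hasModelCompanion {P : Type} [agLang.Structure P] [Finite P] {p₀ : P}
    {s t : agLang.Term (Fin 1)} (T : IsTemplate p₀ s t) {V : AlgClass.{u}}
    (hV : ∀ (A : Type u) [agLang.Structure A], V A ↔ SatisfiesIdentities P A)
    (hsep : ∀ (A : Type u) [agLang.Structure A], SatisfiesIdentities P A → Separated P A) :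
    HasModelCompanion V := by
  let K : AlgClass.{u} := fun A _ => SatisfiesIdentities P A ∧ A ⊨ companionSentence s t
  have hK : ∀ (A : Type u) [agLang.Structure A], A ⊨ Th K → K A := fun A _ hA =>
    ⟨.of_models_Th (fun _ _ hB => hB.1) hA,
      (Theory.model_iff _).1 hA _ fun B _ hB => hB.2⟩
  refine ⟨Th K, ⟨fun A _ hA => ?_, fun A _ hA => ?_⟩, fun B _ S hB hS => ?_⟩
  · have hA' : SatisfiesIdentities P A := .of_models_Th (fun _ _ hB => (hV _).1 hB) hA
    refine ⟨finitaryPower (A →[agLang] P) P, inferInstance, ?_, (hsep A hA').exists_embedding⟩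
    refine (Theory.model_iff _).2 fun φ hφ => hφ _ ⟨separated_finitaryPower.satisfiesIdentities, ?_⟩
    exact (realize_companionSentence s t).2
      ⟨T.exists_param_finitaryPower, T.hasAtomlessCenter_finitaryPower⟩
  · exact ⟨A, inferInstance, (Theory.model_iff _).2 fun φ hφ => hφ A ((hV A).2 (hK A hA).1),
      ⟨Embedding.refl _ _⟩⟩
  · obtain ⟨hB1, hB2⟩ := hK B hB
    obtain ⟨hS1, hS2⟩ := hK S hS
    obtain ⟨⟨c, hs, ht⟩, hS'⟩ := (realize_companionSentence s t).1 hS2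
    exact T.isElementary S (hsep B hB1) (hsep S hS1) ((realize_companionSentence s t).1 hB2).2 hS'
      hs ht

/-! ### The four varieties -/

/-- No genuine parameter is needed: the equations force `c = 1`, and the companion is the theory of
atomless Boolean algebras. -/
lemma isTemplate_twoBA : IsTemplate (one TwoBA) zeroTerm zeroTerm where
  one_meet := by decide
  zero_meet := by decide
  join_zero := by decide
  zero_join := by decide
  star_zero := by decide
  star_one := by decide
  zero_ne_one := by decide
  star_eq_prime_iff := by decide
  exists_const p := by
    obtain rfl | rfl : p = zero TwoBA ∨ p = one TwoBA := by revert p; decide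
    exacts [⟨zeroTerm, realize_zeroTerm _⟩, ⟨oneTerm, realize_oneTerm _⟩]
  exists_char p := by
    obtain rfl | rfl : p = zero TwoBA ∨ p = one TwoBA := by revert p; decide
    · exact ⟨starTerm (.var 0), by simp only [realize_starTerm, Term.realize_var]; decide⟩
    · exact ⟨.var 0, by simp only [Term.realize_var]; decide⟩
  star_param := by rw [realize_zeroTerm]; decide
  prime_param := by rw [realize_zeroTerm]; decide
  exists_hom p := by
    simp only [realize_zeroTerm]
    intro h _
    refine ⟨Hom.id _ _, Function.injective_id, ?_⟩
    revert p
    decide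

/-- The middle element of the chain. -/
def ThreeDoubleStone.mid : ThreeDoubleStone := (1 : Fin 3)

/-- The middle element is the only solution of `x* = 0`, `x' = 1`. -/
lemma isTemplate_threeDoubleStone :
    IsTemplate ThreeDoubleStone.mid zeroTerm oneTerm where
  one_meet := by decide
  zero_meet := by decide
  join_zero := by decide
  zero_join := by decide
  star_zero := by decide
  star_one := by decide
  zero_ne_one := by decide
  star_eq_prime_iff := by decide
  exists_const p := by
    obtain rfl | rfl | rfl : p = zero _ ∨ p = one _ ∨ p = ThreeDoubleStone.mid := by revert p; decide
    exacts [⟨zeroTerm, realize_zeroTerm _⟩, ⟨oneTerm, realize_oneTerm _⟩, ⟨.var 0, rfl⟩]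
  exists_char p := by
    obtain rfl | rfl | rfl : p = zero _ ∨ p = one _ ∨ p = ThreeDoubleStone.mid := by revert p; decide
    · exact ⟨starTerm (.var 0), by simp only [realize_starTerm, Term.realize_var]; decide⟩
    · exact ⟨primeTerm (primeTerm (.var 0)), by
        simp only [realize_primeTerm, Term.realize_var]; decide⟩
    · exact ⟨meetTerm (starTerm (starTerm (.var 0))) (primeTerm (.var 0)), by
        simp only [realize_meetTerm, realize_starTerm, realize_primeTerm, Term.realize_var]
        decide⟩
  star_param := by rw [realize_zeroTerm]; decide
  prime_param := by rw [realize_oneTerm]; decide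
  exists_hom p := by
    simp only [realize_zeroTerm, realize_oneTerm]
    intro h h'
    refine ⟨Hom.id _ _, Function.injective_id, ?_⟩
    revert p
    decide

/-- The middle element of the chain. -/
def ThreeKleeneStone.mid : ThreeKleeneStone := (1 : Fin 3)

/-- The middle element is the only solution of `x* = 0`, `x' = x`. -/
lemma isTemplate_threeKleeneStone :
    IsTemplate ThreeKleeneStone.mid zeroTerm (.var 0) where
  one_meet := by decide
  zero_meet := by decide
  join_zero := by decide
  zero_join := by decide
  star_zero := by decide
  star_one := by decide
  zero_ne_one := by decide
  star_eq_prime_iff := by decide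
  exists_const p := by
    obtain rfl | rfl | rfl : p = zero _ ∨ p = one _ ∨ p = ThreeKleeneStone.mid := by revert p; decide
    exacts [⟨zeroTerm, realize_zeroTerm _⟩, ⟨oneTerm, realize_oneTerm _⟩, ⟨.var 0, rfl⟩]
  exists_char p := by
    obtain rfl | rfl | rfl : p = zero _ ∨ p = one _ ∨ p = ThreeKleeneStone.mid := by revert p; decide
    · exact ⟨starTerm (.var 0), by simp only [realize_starTerm, Term.realize_var]; decide⟩
    · exact ⟨starTerm (primeTerm (.var 0)), by
        simp only [realize_starTerm, realize_primeTerm, Term.realize_var]; decide⟩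
    · exact ⟨meetTerm (starTerm (starTerm (.var 0))) (starTerm (starTerm (primeTerm (.var 0)))), by
        simp only [realize_meetTerm, realize_starTerm, realize_primeTerm, Term.realize_var]
        decide⟩
  star_param := by rw [realize_zeroTerm]; decide
  prime_param := by rw [Term.realize_var]; decide
  exists_hom p := by
    simp only [realize_zeroTerm, Term.realize_var]
    intro h h'
    refine ⟨Hom.id _ _, Function.injective_id, ?_⟩
    revert p
    decide

/-- An atom of the four-element algebra. -/
def FourDMBA.atom : FourDMBA := (true, false)

/-- The map that exchanges the two coordinates. -/
def FourDMBA.swap (x : FourDMBA) : FourDMBA := (x.2, x.1)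

/-- The automorphism of the four-element algebra that exchanges the two atoms. -/
def FourDMBA.swapHom : FourDMBA →[agLang] FourDMBA :=
  homOfOperations FourDMBA.swap (by decide) (by decide) (by decide) (by decide) (by decide) (by decide)

/-- The first equation is the tautology `x* = x*`; the second, `x' = x`, is solved by both atoms,
which an automorphism exchanges. -/
lemma isTemplate_fourDMBA :
    IsTemplate FourDMBA.atom (starTerm (.var 0)) (.var 0) where
  one_meet := by decide
  zero_meet := by decide
  join_zero := by decide
  zero_join := by decide
  star_zero := by decide
  star_one := by decide
  zero_ne_one := by decide
  star_eq_prime_iff := by decide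
  exists_const p := by
    obtain rfl | rfl | rfl | rfl : p = zero _ ∨ p = one _ ∨ p = FourDMBA.atom ∨
      p = FourDMBA.swap FourDMBA.atom := by revert p; decide
    · exact ⟨zeroTerm, realize_zeroTerm _⟩
    · exact ⟨oneTerm, realize_oneTerm _⟩
    · exact ⟨.var 0, rfl⟩
    · exact ⟨starTerm (.var 0), by rw [realize_starTerm, Term.realize_var]; decide⟩
  exists_char p := by
    obtain rfl | rfl | rfl | rfl : p = zero _ ∨ p = one _ ∨ p = FourDMBA.atom ∨
      p = FourDMBA.swap FourDMBA.atom := by revert p; decide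
    · exact ⟨meetTerm (starTerm (.var 0)) (primeTerm (.var 0)), by
        simp only [realize_meetTerm, realize_starTerm, realize_primeTerm, Term.realize_var]
        decide⟩
    · exact ⟨meetTerm (.var 0) (starTerm (primeTerm (.var 0))), by
        simp only [realize_meetTerm, realize_starTerm, realize_primeTerm, Term.realize_var]
        decide⟩
    -- The term `z` is the atom when `x` is that atom and 0 otherwise; `z ∨ z'*` sends an atom to 1
    -- and fixes 0.
    · let z : agLang.Term (Fin 2) := meetTerm (meetTerm (.var 0) (primeTerm (.var 0))) (.var 1)
      exact ⟨joinTerm z (starTerm (primeTerm z)), by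
        simp only [z, realize_joinTerm, realize_meetTerm, realize_starTerm, realize_primeTerm,
          Term.realize_var]
        decide⟩
    · let z : agLang.Term (Fin 2) :=
        meetTerm (meetTerm (.var 0) (primeTerm (.var 0))) (starTerm (.var 1))
      exact ⟨joinTerm z (starTerm (primeTerm z)), by
        simp only [z, realize_joinTerm, realize_meetTerm, realize_starTerm, realize_primeTerm,
          Term.realize_var]
        decide⟩
  star_param := by rw [realize_starTerm, Term.realize_var]
  prime_param := by rw [Term.realize_var]; decide
  exists_hom p := by
    simp only [Term.realize_var]
    intro _ h
    obtain rfl | rfl : p = FourDMBA.atom ∨ p = FourDMBA.swap FourDMBA.atom := by revert p; decide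
    · exact ⟨Hom.id _ _, Function.injective_id, rfl⟩
    · exact ⟨FourDMBA.swapHom, (by decide : Function.Injective FourDMBA.swap), by decide⟩

/-! ### The generated variety compared with identities and separation. -/

lemma isVariety_satisfiesIdentities (P : Type*) [agLang.Structure P] :
    IsVariety.{u} fun A _ => SatisfiesIdentities P A where
  image A B _ _ f hf hA q r hqr v := by
    obtain ⟨w, rfl⟩ := hf.comp_left v
    change q.realize (f ∘ w) = r.realize (f ∘ w)
    rw [HomClass.realize_term, HomClass.realize_term, hA q r hqr]
  subalgebra A _ S hA q r hqr v := by
    refine Subtype.ext ?_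
    change S.subtype _ = S.subtype _
    rw [← HomClass.realize_term, ← HomClass.realize_term, hA q r hqr]
  product I M _ hM q r hqr v := by
    funext i
    let f : (∀ i, M i) →[agLang] M i :=
      { toFun := fun x => x i
        map_fun' := fun _ _ => rfl
        map_rel' := fun R _ => R.elim }
    change f _ = f _
    rw [← HomClass.realize_term, ← HomClass.realize_term, hM i q r hqr]

lemma generatedVariety.satisfiesIdentities {P : Type} [agLang.Structure P] {A : Type u}
    [agLang.Structure A] (hA : generatedVariety.{u} P A) : SatisfiesIdentities P A := by
  refine hA _ (isVariety_satisfiesIdentities P) ?_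
  rintro B _ ⟨e⟩ q r hqr v
  refine e.injective ?_
  rw [← HomClass.realize_term, ← HomClass.realize_term, hqr]

/-- Evaluation embeds `A` into a power of `P` indexed by `Hom(A, P)`, so `A` is isomorphic to a
subalgebra of a power. -/
lemma Separated.generatedVariety {P : Type} [agLang.Structure P] {A : Type u}
    [agLang.Structure A] (hA : Separated P A) : generatedVariety.{u} P A := by
  intro K hK hP
  -- Varieties are classes of algebras in `Type u`, so the factors must be copies of `P` in that
  -- universe.
  let _ : agLang.Structure (ULift.{u} P) := Equiv.ulift.symm.inducedStructure
  let e : P ≃[agLang] ULift.{u} P := Equiv.ulift.symm.inducedStructureEquiv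
  let f : A →[agLang] ((A →[agLang] P) → ULift.{u} P) :=
    { toFun := fun x h => e (h x)
      map_fun' := fun F x => funext fun h => HomClass.map_fun (e.toHom.comp h) F x
      map_rel' := fun r _ => r.elim }
  have hf : Function.Injective f := fun x y hxy =>
    hA x y fun h => e.injective (congrFun hxy h)
  have hrange : K f.range :=
    hK.subalgebra _ _ (hK.product _ _ fun _ => hP _ ⟨e.symm⟩)
  let g : A ≃[agLang] f.range := (embeddingOfInjective f hf).equivRange
  exact hK.image _ _ g.symm.toHom g.symm.surjective hrange

end AlmostGautama

open AlmostGautama in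
theorem mainTheorem5 (V : AlmostGautama.AlgClass.{u})
    (hV : V = AlmostGautama.BA ∨ V = AlmostGautama.RDBLSt ∨
      V = AlmostGautama.RKLSt ∨ V = AlmostGautama.DMBA) :
    AlmostGautama.HasModelCompanion V := by
  obtain rfl | rfl | rfl | rfl := hV
  · exact isTemplate_twoBA.hasModelCompanion
      (fun A _ => ⟨fun h => (IsBoolean.separated h).satisfiesIdentities,
        isBoolean_twoBA.of_identities⟩)
      fun A _ h => (isBoolean_twoBA.of_identities h).separated
  · exact isTemplate_threeDoubleStone.hasModelCompanion
      (fun A _ => ⟨fun h => (IsRegularDoubleStone.separated h).satisfiesIdentities,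
        isRegularDoubleStone_threeDoubleStone.of_identities⟩)
      fun A _ h => (isRegularDoubleStone_threeDoubleStone.of_identities h).separated
  · exact isTemplate_threeKleeneStone.hasModelCompanion
      (fun A _ => ⟨fun h => (IsRegularKleeneStone.separated h).satisfiesIdentities,
        isRegularKleeneStone_threeKleeneStone.of_identities⟩)
      fun A _ h => (isRegularKleeneStone_threeKleeneStone.of_identities h).separated
  -- `DMBA` is defined by generation, not by axioms; the axioms of `IsDeMorganBoolean` serve only to
  -- obtain separation.
  · have hsep : ∀ (A : Type u) [agLang.Structure A], SatisfiesIdentities FourDMBA A →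
        Separated FourDMBA A := fun A _ h =>
      (isDeMorganBoolean_fourDMBA.of_identities h).separated
    exact isTemplate_fourDMBA.hasModelCompanion
      (fun A _ => ⟨generatedVariety.satisfiesIdentities, fun h => (hsep A h).generatedVariety⟩) hsep
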